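/- For a topological group $G$ written additively, let $E(G)$ be the equivalence relation on $G^{\omega}$ (the space of sequences in $G$, with the product topology) given by $$x\,E(G)\,y\iff \lim_{n}\bigl(x(n)-y(n)\bigr)\text{ exists in }G .$$ For equivalence relations $E,F$ on topological spaces $A,B$, write $E\le_B F$ ($E$ is Borel reducible to $F$) if there is a Borel measurable map $f:A\to B$ such that $a\,E\,a'\iff f(a)\,F\,f(a')$ for all $a,a'\in A$. Theorem (Rigid Theorem for Banach spaces). Let $X$ and $Y$ be separable real Banach spaces, regarded as topological groups under addition, such that $Y$ contains no closed linear subspace topologically isomorphic to $c_0$. Then $E(X)\le_B E(Y)$ if and only if $X$ is topologically isomorphic to a closed linear subspace of $Y$. In particular, for all $p,q\in[1,\infty)$, $E(\ell_p)\le_B E(\ell_q)$ if and only if $p=q$, where $\ell_p$ is the Banach space of $p$-summable real sequences indexed by the natural numbers. -/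

import Mathlib

open Filter Topology
open scoped ENNReal ZeroAtInfty

/-- The equivalence relation `E(G)` induced by a topological group `G`, written additively:
two sequences `x, y` in `G` (points of the power `G^ω`) are equivalent iff `lim_n (x n - y n)`
exists in `G`. -/
def inducedEquivRel (G : Type*) [AddGroup G] [TopologicalSpace G] [IsTopologicalAddGroup G] :
    Setoid (ℕ → G) where
  r x y := ∃ l : G, Tendsto (fun n => x n - y n) atTop (𝓝 l)
  iseqv :=
    { refl := fun x => ⟨0, by simpa using tendsto_const_nhds⟩
      symm := fun {x y} ⟨l, h⟩ => ⟨-l, by simpa using h.neg⟩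
      trans := fun {x y z} ⟨l, h⟩ ⟨m, h2⟩ => ⟨l + m, by simpa using h.add h2⟩ }

/-- Borel reducibility `E ≤_B F` of equivalence relations on topological spaces: there is a map
that is measurable for the Borel σ-algebras of the two topologies and reduces `E` to `F`. -/
def BorelReducible {A B : Type*} [TopologicalSpace A] [TopologicalSpace B]
    (E : Setoid A) (F : Setoid B) : Prop :=
  ∃ f : A → B, @Measurable A B (borel A) (borel B) f ∧ ∀ a a' : A, E a a' ↔ F (f a) (f a')

/-- `X` is topologically (linearly) isomorphic to a closed linear subspace of `Y`. The scalars are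
real. -/
def IsoToClosedSubspace (X Y : Type*) [NormedAddCommGroup X] [NormedSpace ℝ X]
    [NormedAddCommGroup Y] [NormedSpace ℝ Y] : Prop :=
  ∃ Z : Submodule ℝ Y, IsClosed (Z : Set Y) ∧ Nonempty (X ≃L[ℝ] Z)

/-! A closed embedding applied coordinatewise is a continuous reduction. The substance is the
converse, together with the pairwise non-embeddability of the `ℓ_p`.

Let `f` reduce `E(X)` to `E(Y)`, and let `Γ` be the countable group of eventually constant sequences
with values in a countable dense rational subspace `D` of `X`. Baire category gives a base point `z`
around which the increments `Ψ h = f (z + h) - f z` behave well: `Ψ (g + h)` is uniformly close to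
`Ψ g + Ψ h` once `h ∈ Γ` vanishes on a long initial segment depending on `g` (`exists_isIncrement`).
Write `Φ h` for the limit of `Ψ h`. As `Ψ w` converges iff `w` does, for every `w`, gluing late
elements `h i` into an infinite sum `w` (`IsIncrement.exists_sum`) links convergence of `w` to that
of `∑ Φ (h i)` and to uniform smallness of `Ψ (h i)`.

It follows that small late `h` have small increments. If finitely supported small late `h` did not
have small `Φ`, disjointly supported ones would give a series in `Y` with bounded subset sums and
non-null terms, hence a copy of `c₀` (Bessaga–Pełczyński, through Rosenthal's lemma). So `Φ` of a
step of height `u` converges as the step moves out; the limit is bounded and additive for small `u`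
and extends to a continuous linear map `S`. Gluing steps shows that `S` reflects convergence of
walks whose steps tend to zero, which forces `S` to be bounded below: otherwise one walks slowly
back and forth along vectors that `S` almost kills.

For the sequence spaces, a gliding hump shows that differences from a bounded separated sequence in
`ℓ_q` have sums growing like `N ^ (1 / q)`. Unit vectors of `ℓ_p` give `N ^ (1 / p)` and those of
`c₀` stay bounded, so neither embeds in `ℓ_q` unless it is `ℓ_p` with `p = q`. -/

/-! ### Baire category and the generic base point. -/

/-- Countably many Borel sets simultaneously become relatively open on a suitable dense `Gδ`. -/
theorem exists_residual_forall_iff_isOpen {Z ι : Type*} [TopologicalSpace Z] [MeasurableSpace Z]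
    [BorelSpace Z] [Countable ι] (B : ι → Set Z) (hB : ∀ i, MeasurableSet (B i)) :
    ∃ C ∈ residual Z, ∀ i, ∃ U : Set Z, IsOpen U ∧ ∀ x ∈ C, x ∈ B i ↔ x ∈ U := by
  choose U hU hBU using fun i => (hB i).residualEq_isOpen
  refine ⟨{x | ∀ i, x ∈ B i ↔ x ∈ U i}, ?_, fun i => ⟨U i, hU i, fun x hx => hx i⟩⟩
  exact eventually_countable_forall.2 fun i => (hBU i).mem_iff

/-- A countable subgroup can be translated into any residual set, which may be taken to be a
countable intersection of open sets. -/
theorem exists_translate_subset_iInter_isOpen {Z : Type*} [AddCommGroup Z] [TopologicalSpace Z]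
    [IsTopologicalAddGroup Z] [BaireSpace Z] (Γ : AddSubgroup Z) [Countable Γ]
    {C : Set Z} (hC : C ∈ residual Z) :
    ∃ (z : Z) (O : ℕ → Set Z), (∀ k, IsOpen (O k)) ∧ (∀ g ∈ Γ, ∀ k, z + g ∈ O k) ∧
      (⋂ k, O k) ⊆ C := by
  obtain ⟨t, htC, htG, htd⟩ := mem_residual.1 hC
  obtain ⟨O, hO, rfl⟩ := isGδ_iff_eq_iInter_nat.1 htG
  have h1 : ∀ g : Γ, ∀ᶠ z in residual Z, z + (g : Z) ∈ ⋂ k, O k := fun g =>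
    (tendsto_residual_of_isOpenMap (continuous_add_const (g : Z)) (isOpenMap_add_right (g : Z))).eventually
      (residual_of_dense_Gδ htG htd)
  obtain ⟨z, hz⟩ := (dense_of_mem_residual (eventually_countable_forall.2 h1)).nonempty
  exact ⟨z, O, hO, fun g hg k => Set.mem_iInter.1 (hz ⟨g, hg⟩) k, htC⟩

/-- For a Borel map `f` into sequences whose increments along a countable subgroup `Γ` converge,
there is a base point `z` such that on a `Gδ` set containing `z + Γ` all coordinates of `f` are
continuous and the increments are continuous at `z`, uniformly in the coordinate. -/
theorem exists_base_uniform_increment {Z Y : Type*} [AddCommGroup Z] [TopologicalSpace Z]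
    [IsTopologicalAddGroup Z] [BaireSpace Z] [MeasurableSpace Z] [BorelSpace Z]
    [NormedAddCommGroup Y] [SecondCountableTopology Y] [MeasurableSpace Y] [BorelSpace Y]
    (Γ : AddSubgroup Z) [Countable Γ] (f : Z → ℕ → Y) (hf : ∀ n, Measurable fun x => f x n)
    (hΓ : ∀ g ∈ Γ, ∀ x, CauchySeq fun n => f (x + g) n - f x n) :
    ∃ (z : Z) (O : ℕ → Set Z), (∀ k, IsOpen (O k)) ∧ (∀ g ∈ Γ, ∀ k, z + g ∈ O k) ∧
      (∀ n, ContinuousOn (fun x => f x n) (⋂ k, O k)) ∧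
      ∀ g ∈ Γ, ∀ ε > 0, ∃ V ∈ 𝓝 (0 : Z), ∀ h ∈ Γ, h ∈ V →
        ∀ n, ‖(f (z + h + g) n - f (z + h) n) - (f (z + g) n - f z n)‖ ≤ ε := by
  let B1 : ℕ × TopologicalSpace.countableBasis Y → Set Z := fun p => {x | f x p.1 ∈ (p.2 : Set Y)}
  -- Only countably many Cauchy moduli are recorded, so a single residual set makes all of them
  -- relatively open.
  let B2 : Γ × ℕ × ℕ → Set Z := fun p => {x | ∀ m ≥ p.2.2, ∀ n ≥ p.2.2,
    ‖(f (x + p.1) m - f x m) - (f (x + p.1) n - f x n)‖ ≤ 1 / ((p.2.1 : ℝ) + 1)}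
  have hB1 : ∀ p, MeasurableSet (B1 p) := fun p =>
    hf p.1 (TopologicalSpace.isOpen_of_mem_countableBasis p.2.2).measurableSet
  have hB2 : ∀ p, MeasurableSet (B2 p) := by
    intro p
    have hm : ∀ n, Measurable fun x => f (x + p.1) n := fun n =>
      (hf n).comp (continuous_add_const (p.1 : Z)).measurable
    simp only [B2, Set.ofPred_forall]
    refine MeasurableSet.iInter fun m => MeasurableSet.iInter fun _ => MeasurableSet.iInter fun n =>
      MeasurableSet.iInter fun _ => ?_
    exact measurableSet_le (((hm m).sub (hf m)).sub ((hm n).sub (hf n))).norm measurable_const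
  obtain ⟨C, hC, hCB⟩ := exists_residual_forall_iff_isOpen (Sum.elim B1 B2)
    (by rintro (p | p); exacts [hB1 p, hB2 p])
  obtain ⟨z, O, hO, hzO, hOC⟩ := exists_translate_subset_iInter_isOpen Γ hC
  have hzC : ∀ g ∈ Γ, z + g ∈ ⋂ k, O k := fun g hg => Set.mem_iInter.2 (hzO g hg)
  have hcont : ∀ n, ContinuousOn (fun x => f x n) (⋂ k, O k) := by
    intro n x hx
    refine (nhds_basis_opens _ |>.tendsto_right_iff).2 ?_
    rintro V ⟨hxV, hV⟩
    obtain ⟨W, hW, hxW, hWV⟩ :=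
      (TopologicalSpace.isBasis_countableBasis Y).exists_subset_of_mem_open hxV hV
    obtain ⟨U, hU, hUB⟩ := hCB (Sum.inl (n, ⟨W, hW⟩))
    have hxU : x ∈ U := (hUB x (hOC hx)).1 hxW
    filter_upwards [self_mem_nhdsWithin, mem_nhdsWithin_of_mem_nhds (hU.mem_nhds hxU)] with y hy hyU
    exact hWV ((hUB y (hOC hy)).2 hyU)
  refine ⟨z, O, hO, hzO, hcont, fun g hg ε hε => ?_⟩
  -- The modulus `N` valid at `z` persists at nearby `z + h` by openness; the finitely many
  -- coordinates up to `N` are handled by continuity. Beyond `N` the cost is two tails and one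
  -- comparison at `N`, each at most `ε / 4`.
  obtain ⟨k, hk⟩ := exists_nat_one_div_lt (show 0 < ε / 4 by positivity)
  obtain ⟨N, hN⟩ := Metric.cauchySeq_iff.1 (hΓ g hg z) (1 / ((k : ℝ) + 1)) (by positivity)
  obtain ⟨U, hU, hUB⟩ := hCB (Sum.inr (⟨g, hg⟩, k, N))
  have hz0 : z ∈ ⋂ k, O k := by simpa using hzC 0 Γ.zero_mem
  have hzU : z ∈ U := (hUB z (hOC hz0)).1 fun m hm n hn => by
    have := hN m hm n hn
    rw [dist_eq_norm] at this
    exact this.le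
  have hnear : ∀ n, ∀ a ∈ Γ, ∃ V ∈ 𝓝 (0 : Z), ∀ h ∈ Γ, h ∈ V →
      ‖f (z + h + a) n - f (z + a) n‖ ≤ ε / 8 := by
    intro n a ha
    have hlim := Metric.tendsto_nhds.1 (hcont n (z + a) (hzC a ha)) (ε / 8) (by positivity)
    obtain ⟨V', hV', hVV⟩ := mem_nhdsWithin_iff_exists_mem_nhds_inter.1 hlim
    have ht : Tendsto (fun h : Z => z + h + a) (𝓝 0) (𝓝 (z + a)) := by
      have : Continuous fun h : Z => z + h + a := by fun_prop
      simpa using this.tendsto 0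
    refine ⟨_, ht hV', fun h hh hhV => ?_⟩
    have := hVV ⟨hhV, by simpa only [add_assoc] using hzC _ (Γ.add_mem hh ha)⟩
    rw [Set.mem_ofPred_eq, dist_eq_norm] at this
    exact this.le
  have hlow : ∀ n, ∃ V ∈ 𝓝 (0 : Z), ∀ h ∈ Γ, h ∈ V →
      ‖(f (z + h + g) n - f (z + h) n) - (f (z + g) n - f z n)‖ ≤ ε / 4 := by
    intro n
    obtain ⟨V1, hV1, h1⟩ := hnear n g hg
    obtain ⟨V2, hV2, h2⟩ := hnear n 0 Γ.zero_mem
    refine ⟨V1 ∩ V2, inter_mem hV1 hV2, fun h hh hv => ?_⟩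
    have e1 := h1 h hh hv.1
    have e2 := h2 h hh hv.2
    simp only [add_zero] at e2
    have : (f (z + h + g) n - f (z + h) n) - (f (z + g) n - f z n)
      = (f (z + h + g) n - f (z + g) n) - (f (z + h) n - f z n) := by abel
    rw [this]
    linarith [norm_sub_le (f (z + h + g) n - f (z + g) n) (f (z + h) n - f z n)]
  choose V hV hVs using hlow
  have htU : Tendsto (fun h : Z => z + h) (𝓝 0) (𝓝 z) := by
    simpa using (continuous_const_add z).tendsto 0
  refine ⟨(⋂ n ∈ Finset.range (N + 1), V n) ∩ (fun h => z + h) ⁻¹' U,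
    inter_mem ((biInter_finset_mem _).2 fun n _ => hV n) (htU (hU.mem_nhds hzU)), ?_⟩
  rintro h hh ⟨hh1, hh2⟩ n
  have hlo : ∀ n ≤ N, ‖(f (z + h + g) n - f (z + h) n) - (f (z + g) n - f z n)‖ ≤ ε / 4 :=
    fun n hn => hVs n h hh (Set.mem_iInter₂.1 hh1 n (Finset.mem_range.2 (by omega)))
  rcases le_total n N with hn | hn
  · linarith [hlo n hn]
  · have a1 := (hUB (z + h) (hOC (hzC h hh))).2 hh2 n hn N le_rfl
    have a2 := (hUB z (hOC hz0)).2 hzU n hn N le_rfl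
    have a3 := hlo N le_rfl
    simp only at a1 a2
    have : (f (z + h + g) n - f (z + h) n) - (f (z + g) n - f z n)
      = ((f (z + h + g) n - f (z + h) n) - (f (z + h + g) N - f (z + h) N))
        - ((f (z + g) n - f z n) - (f (z + g) N - f z N))
        + ((f (z + h + g) N - f (z + h) N) - (f (z + g) N - f z N)) := by abel
    rw [this]
    refine (norm_add_le _ _).trans ?_
    linarith [norm_sub_le ((f (z + h + g) n - f (z + h) n) - (f (z + h + g) N - f (z + h) N))
      ((f (z + g) n - f z n) - (f (z + g) N - f z N))]

/-- Dependent choice along `ℕ` where each choice may depend on all previous ones. -/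
theorem exists_seq_of_forall_history {α : Type*} [Nonempty α] (P : ℕ → (ℕ → α) → α → Prop)
    (hloc : ∀ i s s' a, (∀ j < i, s j = s' j) → P i s a → P i s' a)
    (Good : α → Prop) (hex : ∀ i s, (∀ j < i, Good (s j)) → ∃ a, Good a ∧ P i s a) :
    ∃ s : ℕ → α, ∀ i, Good (s i) ∧ P i s (s i) := by
  classical
  let pick : ℕ → (ℕ → α) → α := fun i s =>
    if h : ∀ j < i, Good (s j) then (hex i s h).choose else Classical.arbitrary α
  have hpick : ∀ i s, (∀ j < i, Good (s j)) → Good (pick i s) ∧ P i s (pick i s) := by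
    intro i s h
    simp only [pick, dif_pos h]
    exact (hex i s h).choose_spec
  let st : ℕ → (ℕ → α) := fun n => Nat.rec (fun _ => Classical.arbitrary α)
    (fun i s => Function.update s i (pick i s)) n
  have hst : ∀ i, st (i + 1) = Function.update (st i) i (pick i (st i)) := fun i => rfl
  let s : ℕ → α := fun i => st (i + 1) i
  have hstab : ∀ n i, i < n → st n i = s i := by
    intro n
    induction n with
    | zero => intro i hi; omega
    | succ n ih =>
      intro i hi
      rcases Nat.lt_succ_iff_lt_or_eq.1 hi with h | rfl
      · rw [hst, Function.update_of_ne (by omega), ih i h]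
      · rfl
  have hs : ∀ i, s i = pick i (st i) := fun i => by simp [s, hst]
  refine ⟨s, fun i => ?_⟩
  induction i using Nat.strong_induction_on with
  | _ i ih =>
    have hg : ∀ j < i, Good (st i j) := fun j hj => by rw [hstab i j hj]; exact (ih j hj).1
    have := hpick i (st i) hg
    rw [hs]
    exact ⟨this.1, hloc i _ _ _ (fun j hj => hstab i j hj) this.2⟩

/-! ### Increments of a reduction around the base point. -/

section Increment

variable {X Y : Type*} [NormedAddCommGroup X] [NormedAddCommGroup Y]

/-- The filter on `Γ` of sequences vanishing on longer and longer initial segments. -/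
def tailFilter (Γ : AddSubgroup (ℕ → X)) : Filter (ℕ → X) :=
  ⨅ K : ℕ, 𝓟 {h | h ∈ Γ ∧ ∀ n < K, h n = 0}

theorem eventually_tailFilter {Γ : AddSubgroup (ℕ → X)} {p : (ℕ → X) → Prop} :
    (∀ᶠ h in tailFilter Γ, p h) ↔ ∃ K : ℕ, ∀ h ∈ Γ, (∀ n < K, h n = 0) → p h := by
  unfold tailFilter Filter.Eventually
  rw [mem_iInf_of_directed]
  · simp only [mem_principal]
    exact ⟨fun ⟨K, h⟩ => ⟨K, fun g hg h0 => h ⟨hg, h0⟩⟩, fun ⟨K, h⟩ => ⟨K, fun g hg => h g hg.1 hg.2⟩⟩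
  · refine directed_of_isDirected_le fun i j hij => ?_
    exact principal_mono.2 fun h hh => ⟨hh.1, fun n hn => hh.2 n (hn.trans_le hij)⟩

theorem eventually_tailFilter_mem (Γ : AddSubgroup (ℕ → X)) : ∀ᶠ h in tailFilter Γ, h ∈ Γ :=
  eventually_tailFilter.2 ⟨0, fun _ h _ => h⟩

theorem eventually_tailFilter_eq_zero (Γ : AddSubgroup (ℕ → X)) (K : ℕ) :
    ∀ᶠ h in tailFilter Γ, ∀ n ≤ K, h n = 0 :=
  eventually_tailFilter.2 ⟨K + 1, fun _ _ h n hn => h n (by omega)⟩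

/-- The properties of the increments `Ψ h n = f (z + h) n - f z n` of a reduction `f` around a
generic base point `z`; `Φ h` is the limit of `Ψ h`. -/
structure IsIncrement (Γ : AddSubgroup (ℕ → X)) (Ψ : (ℕ → X) → ℕ → Y) (Φ : (ℕ → X) → Y) :
    Prop where
  const : ∀ g ∈ Γ, ∃ K, ∀ n ≥ K, g n = g K
  zero : ∀ n, Ψ 0 n = 0
  tendsto : ∀ g ∈ Γ, Tendsto (Ψ g) atTop (𝓝 (Φ g))
  add : ∀ g ∈ Γ, ∀ ε > 0, ∀ᶠ h in tailFilter Γ, ∀ n, ‖Ψ (g + h) n - Ψ g n - Ψ h n‖ ≤ ε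
  small : ∀ g ∈ Γ, ∀ N : ℕ, ∀ ε > 0, ∀ᶠ h in tailFilter Γ, ∀ n ≤ N, ‖Ψ (g + h) n - Ψ g n‖ ≤ ε
  -- `O g k` is an agreement length that keeps `z + w` in the `k`-th open set of the `Gδ`; this
  -- gives continuity at points `w` outside `Γ`.
  limit : ∃ O : (ℕ → X) → ℕ → ℕ, ∀ (w : ℕ → X) (s : ℕ → ℕ → X), (∀ k, s k ∈ Γ) →
    (∀ k, ∀ n ≤ O (s k) k, w n = s k n) → Tendsto s atTop (𝓝 w) →
    ∀ n, Tendsto (fun k => Ψ (s k) n) atTop (𝓝 (Ψ w n))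
  conv_iff : ∀ w, (∃ l, Tendsto (Ψ w) atTop (𝓝 l)) ↔ ∃ l, Tendsto w atTop (𝓝 l)

theorem exists_forall_lt_eq_of_isOpen {O : Set (ℕ → X)} (hO : IsOpen O) {x : ℕ → X} (hx : x ∈ O) :
    ∃ K : ℕ, ∀ y : ℕ → X, (∀ n < K, y n = x n) → y ∈ O := by
  obtain ⟨I, u, hu, hI⟩ := isOpen_pi_iff.1 hO x hx
  refine ⟨I.sup id + 1, fun y hy => hI fun i hi => ?_⟩
  rw [hy i (Nat.lt_succ_of_le (Finset.le_sup (f := id) hi))]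
  exact (hu i hi).2

theorem tendsto_tailFilter (Γ : AddSubgroup (ℕ → X)) : Tendsto id (tailFilter Γ) (𝓝 0) := by
  intro V hV
  obtain ⟨O, hOV, hO, h0⟩ := mem_nhds_iff.1 hV
  obtain ⟨K, hK⟩ := exists_forall_lt_eq_of_isOpen hO h0
  exact eventually_tailFilter.2 ⟨K, fun h _ hh => hOV (hK h hh)⟩

/-- For every `x` the difference `f (x + w) - f x` converges iff `w` does, since `f` is a reduction.
The fields `add`, `small` and `limit` then come respectively from the uniform increments at `z`,
from continuity at points of `z + Γ`, and from continuity on the whole `Gδ`. -/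
theorem exists_isIncrement [CompleteSpace X] [SecondCountableTopology X] [CompleteSpace Y]
    [SecondCountableTopology Y] (hred : BorelReducible (inducedEquivRel X) (inducedEquivRel Y))
    (Γ : AddSubgroup (ℕ → X)) [Countable Γ] (hΓ : ∀ g ∈ Γ, ∃ K, ∀ n ≥ K, g n = g K) :
    ∃ (Ψ : (ℕ → X) → ℕ → Y) (Φ : (ℕ → X) → Y), IsIncrement Γ Ψ Φ := by
  obtain ⟨f, hfm, hf⟩ := hred
  have hf' : ∀ x w : ℕ → X, (∃ l, Tendsto (fun n => f (x + w) n - f x n) atTop (𝓝 l)) ↔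
      ∃ l, Tendsto w atTop (𝓝 l) := by
    intro x w
    have h : (∃ l, Tendsto (fun n => (x + w) n - x n) atTop (𝓝 l)) ↔
        ∃ l, Tendsto (fun n => f (x + w) n - f x n) atTop (𝓝 l) := hf (x + w) x
    rw [← h]
    simp
  have hΓc : ∀ g ∈ Γ, ∃ l, Tendsto g atTop (𝓝 l) := by
    intro g hg
    obtain ⟨K, hK⟩ := hΓ g hg
    exact ⟨g K, tendsto_atTop_of_eventually_const (i₀ := K) hK⟩
  let _ : MeasurableSpace X := borel X
  have _ : BorelSpace X := ⟨rfl⟩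
  let _ : MeasurableSpace Y := borel Y
  have _ : BorelSpace Y := ⟨rfl⟩
  -- Second countability identifies the Borel σ-algebra of the power with the product σ-algebra.
  have hfm' : Measurable f := by
    have e1 : (MeasurableSpace.pi : MeasurableSpace (ℕ → X)) = borel _ := BorelSpace.measurable_eq
    have e2 : (MeasurableSpace.pi : MeasurableSpace (ℕ → Y)) = borel _ := BorelSpace.measurable_eq
    rw [e1, e2]
    exact hfm
  obtain ⟨z, O, hO, hzO, hcont, hunif⟩ := exists_base_uniform_increment Γ f
    (fun n => (measurable_pi_apply n).comp hfm')
    (fun g hg x => ((hf' x g).2 (hΓc g hg)).choose_spec.cauchySeq)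
  have hlim : ∀ g : ℕ → X, ∃ l, g ∈ Γ → Tendsto (fun n => f (z + g) n - f z n) atTop (𝓝 l) := by
    intro g
    by_cases hg : g ∈ Γ
    · obtain ⟨l, hl⟩ := (hf' z g).2 (hΓc g hg)
      exact ⟨l, fun _ => hl⟩
    · exact ⟨0, fun h => absurd h hg⟩
  choose Φ hΦ using hlim
  have hzC : ∀ g ∈ Γ, z + g ∈ ⋂ k, O k := fun g hg => Set.mem_iInter.2 (hzO g hg)
  refine ⟨fun h n => f (z + h) n - f z n, Φ, hΓ, by simp, hΦ, ?_, ?_, ?_, fun w => hf' z w⟩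
  · intro g hg ε hε
    obtain ⟨V, hV, hVs⟩ := hunif g hg ε hε
    filter_upwards [tendsto_tailFilter Γ hV, eventually_tailFilter_mem Γ] with h hhV hh n
    convert hVs h hh hhV n using 2
    rw [show z + (g + h) = z + h + g by abel]
    abel
  · intro g hg N ε hε
    have h1 : ∀ n, ∀ᶠ h in tailFilter Γ, ‖f (z + (g + h)) n - f (z + g) n‖ ≤ ε := by
      intro n
      have ht : Tendsto (fun h : ℕ → X => z + (g + h)) (tailFilter Γ) (𝓝[⋂ k, O k] (z + g)) := by
        refine tendsto_nhdsWithin_iff.2 ⟨?_, ?_⟩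
        · have hc : Continuous fun h : ℕ → X => z + (g + h) := by fun_prop
          have := (hc.tendsto 0).comp (tendsto_tailFilter Γ)
          simpa using this
        · filter_upwards [eventually_tailFilter_mem Γ] with h hh
          exact hzC _ (Γ.add_mem hg hh)
      filter_upwards [ht (Metric.tendsto_nhds.1 (hcont n _ (hzC g hg)) ε hε)] with h hh
      have : dist (f (z + (g + h)) n) (f (z + g) n) < ε := hh
      rw [dist_eq_norm] at this
      exact this.le
    have h2 : ∀ᶠ h in tailFilter Γ, ∀ n ∈ Finset.range (N + 1),
        ‖f (z + (g + h)) n - f (z + g) n‖ ≤ ε :=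
      (Finset.eventually_all _).2 fun n _ => h1 n
    filter_upwards [h2] with h hh n hn
    convert hh n (Finset.mem_range.2 (by omega)) using 2
    abel
  · have h1 : ∀ (g : ℕ → X) (k : ℕ), ∃ K : ℕ, g ∈ Γ →
        ∀ w : ℕ → X, (∀ n < K, w n = g n) → z + w ∈ O k := by
      intro g k
      by_cases hg : g ∈ Γ
      · obtain ⟨K, hK⟩ := exists_forall_lt_eq_of_isOpen (hO k) (hzO g hg k)
        exact ⟨K, fun _ w hw => hK _ fun n hn => by simp [hw n hn]⟩
      · exact ⟨0, fun h => absurd h hg⟩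
    choose K hK using h1
    refine ⟨K, fun w s hs hws hsw n => ?_⟩
    have hw : z + w ∈ ⋂ k, O k :=
      Set.mem_iInter.2 fun k => hK (s k) k (hs k) w fun n hn => hws k n hn.le
    have ht : Tendsto (fun k => z + s k) atTop (𝓝[⋂ k, O k] (z + w)) :=
      tendsto_nhdsWithin_iff.2 ⟨hsw.const_add z, Eventually.of_forall fun k => hzC _ (hs k)⟩
    exact ((hcont n _ hw).tendsto.comp ht).sub_const _

end Increment

/-! ### Convergence of a diagonal limit of rows. -/

section Interpolation

variable {Y : Type*} [NormedAddCommGroup Y] {a : ℕ → ℕ → Y} {A G : ℕ → Y} {M : ℕ → ℕ} {ε : ℕ → ℝ}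

/-- A doubly indexed family with row limits `A` and column limits `G`, where `M` separates the
indices close to the row limit from those close to the column limit. If `G` converges, then
consecutive rows become uniformly close. -/
theorem eventually_norm_row_sub_le_of_tendsto (hε : Tendsto ε atTop (𝓝 0)) (hM : StrictMono M)
    (h1 : ∀ i, ∀ n ≥ M i, ‖a i n - A i‖ ≤ ε i) (h2 : ∀ i, ∀ n ≤ M i, ‖G n - a i n‖ ≤ ε i)
    (h3 : ∀ i, ∀ n ≤ M i, ‖a (i + 1) n - a i n‖ ≤ ε i) {l : Y} (hG : Tendsto G atTop (𝓝 l))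
    {δ : ℝ} (hδ : 0 < δ) : ∀ᶠ i in atTop, ∀ n, ‖a (i + 1) n - a i n‖ ≤ δ := by
  obtain ⟨N, hN⟩ := Metric.tendsto_atTop.1 hG (δ / 8) (by positivity)
  have e1 : ∀ᶠ i in atTop, ε i < δ / 8 := hε.eventually_lt_const (by positivity)
  filter_upwards [e1, (tendsto_add_atTop_nat 1).eventually e1, eventually_ge_atTop N] with i hi hi' hiN n
  -- At the index `M j` both estimates hold, so `A j` is close to `G (M j)` and hence to `l`.
  have hA : ∀ j, N ≤ j → ‖A j - l‖ ≤ δ / 8 + 2 * ε j := by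
    intro j hj
    have x1 := h1 j (M j) le_rfl
    have x2 := h2 j (M j) le_rfl
    have x3 := (hN (M j) (hj.trans (hM.id_le j))).le
    rw [dist_eq_norm] at x3
    have : A j - l = (G (M j) - l) - (G (M j) - a j (M j)) - (a j (M j) - A j) := by abel
    rw [this]
    linarith [norm_sub_le ((G (M j) - l) - (G (M j) - a j (M j))) (a j (M j) - A j),
      norm_sub_le (G (M j) - l) (G (M j) - a j (M j))]
  have hAi := hA i hiN
  -- Between `M i` and `M (i + 1)` row `i` is near `A i` and row `i + 1` near `G`; beyond, both rows
  -- are near their limits. All of these are near `l`.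
  rcases le_total n (M i) with hn | hn
  · linarith [h3 i n hn]
  · have x1 := h1 i n hn
    rcases le_total n (M (i + 1)) with hn' | hn'
    · have x2 := h2 (i + 1) n hn'
      have x3 := (hN n (hiN.trans ((hM.id_le i).trans hn))).le
      rw [dist_eq_norm] at x3
      have : a (i + 1) n - a i n = (G n - l) - (G n - a (i + 1) n) - (a i n - A i) - (A i - l) := by
        abel
      rw [this]
      linarith [norm_sub_le ((G n - l) - (G n - a (i + 1) n) - (a i n - A i)) (A i - l),
        norm_sub_le ((G n - l) - (G n - a (i + 1) n)) (a i n - A i),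
        norm_sub_le (G n - l) (G n - a (i + 1) n)]
    · have x2 := h1 (i + 1) n hn'
      have x3 := hA (i + 1) (by omega)
      have : a (i + 1) n - a i n = (a (i + 1) n - A (i + 1)) - (a i n - A i) + (A (i + 1) - l)
        - (A i - l) := by abel
      rw [this]
      linarith [norm_sub_le ((a (i + 1) n - A (i + 1)) - (a i n - A i) + (A (i + 1) - l)) (A i - l),
        norm_add_le ((a (i + 1) n - A (i + 1)) - (a i n - A i)) (A (i + 1) - l),
        norm_sub_le (a (i + 1) n - A (i + 1)) (a i n - A i)]

/-- In the situation of `eventually_norm_row_sub_le_of_tendsto`, convergence of the row limits and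
uniform closeness of consecutive rows imply that `G` converges. -/
theorem tendsto_of_eventually_norm_row_sub_le (hε : Tendsto ε atTop (𝓝 0)) (hM : StrictMono M)
    (h1 : ∀ i, ∀ n ≥ M i, ‖a i n - A i‖ ≤ ε i) (h2 : ∀ i, ∀ n ≤ M i, ‖G n - a i n‖ ≤ ε i)
    {l : Y} (hA : Tendsto A atTop (𝓝 l))
    (hr : ∀ δ > 0, ∀ᶠ i in atTop, ∀ n, ‖a (i + 1) n - a i n‖ ≤ δ) : Tendsto G atTop (𝓝 l) := by
  refine Metric.tendsto_atTop.2 fun δ hδ => ?_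
  have e1 : ∀ᶠ i in atTop, ε i < δ / 8 := hε.eventually_lt_const (by positivity)
  have e2 : ∀ᶠ i in atTop, dist (A i) l < δ / 8 := Metric.tendsto_nhds.1 hA _ (by positivity)
  obtain ⟨I, hI⟩ := eventually_atTop.1 (e1.and (e2.and (hr (δ / 8) (by positivity))))
  refine ⟨M I, fun n hn => ?_⟩
  have hex : ∃ j, n ≤ M j := ⟨n, hM.id_le n⟩
  -- For such `i` the chain is `G n ≈ a (i + 1) n ≈ a i n ≈ A i ≈ l`.
  obtain ⟨i, hi, hin, hin'⟩ : ∃ i, I ≤ i ∧ M i ≤ n ∧ n ≤ M (i + 1) := by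
    classical
    by_cases h : n = M I
    · exact ⟨I, le_rfl, h.ge, h.le.trans (hM.monotone (Nat.le_succ I))⟩
    · have h0 : I < Nat.find hex := by
        by_contra hc
        have := (Nat.find_spec hex).trans (hM.monotone (not_lt.1 hc))
        omega
      refine ⟨Nat.find hex - 1, by omega, ?_, ?_⟩
      · exact (not_le.1 (Nat.find_min hex (show Nat.find hex - 1 < Nat.find hex by omega))).le
      · rw [Nat.sub_add_cancel (by omega)]; exact Nat.find_spec hex
  have x1 := h1 i n hin
  have x2 := h2 (i + 1) n hin'
  have x3 := (hI i hi).2.2 n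
  have x4 := (hI i hi).2.1.le
  rw [dist_eq_norm] at x4 ⊢
  have : G n - l = (G n - a (i + 1) n) + (a (i + 1) n - a i n) + (a i n - A i) + (A i - l) := by abel
  rw [this]
  linarith [norm_add_le ((G n - a (i + 1) n) + (a (i + 1) n - a i n) + (a i n - A i)) (A i - l),
    norm_add_le ((G n - a (i + 1) n) + (a (i + 1) n - a i n)) (a i n - A i),
    norm_add_le (G n - a (i + 1) n) (a (i + 1) n - a i n), (hI i hi).1, (hI (i + 1) (by omega)).1]

end Interpolation

/-! ### Gluing late increments into an infinite sum. -/

section Increment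

variable {X Y : Type*} [NormedAddCommGroup X] [NormedAddCommGroup Y] {Γ : AddSubgroup (ℕ → X)}
  {Ψ : (ℕ → X) → ℕ → Y} {Φ : (ℕ → X) → Y}

/-- Any choice of requirements, each met by arbitrarily late elements of `Γ`, is met by a sequence
`h` with successive supports such that the increment along the infinite sum `w` of the `h i` is
controlled by the increments along the individual `h i`. -/
theorem IsIncrement.exists_sum [CompleteSpace Y] (H : IsIncrement Γ Ψ Φ) (Q : ℕ → (ℕ → X) → Prop)
    (hQ : ∀ i, ∃ᶠ h in tailFilter Γ, Q i h) :
    ∃ (h : ℕ → ℕ → X) (K : ℕ → ℕ) (w : ℕ → X), (∀ i, h i ∈ Γ) ∧ (∀ i, Q i (h i)) ∧ StrictMono K ∧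
      (∀ i, ∀ n ≤ K i, h i n = 0) ∧ (∀ i, ∀ n ≥ K (i + 1), h i n = h i (K (i + 1))) ∧
      (∀ n m, n ≤ m → w n = ∑ j ∈ Finset.range m, h j n) ∧
      ((∃ l, Tendsto w atTop (𝓝 l)) → ∀ δ > 0, ∀ᶠ i in atTop, ∀ n, ‖Ψ (h i) n‖ ≤ δ) ∧
      ((∃ l, Tendsto (fun m => ∑ i ∈ Finset.range m, Φ (h i)) atTop (𝓝 l)) →
        (∀ δ > 0, ∀ᶠ i in atTop, ∀ n, ‖Ψ (h i) n‖ ≤ δ) → ∃ l, Tendsto w atTop (𝓝 l)) := by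
  classical
  obtain ⟨O, hO⟩ := H.limit
  have hKc : ∀ g, ∃ K : ℕ, g ∈ Γ → ∀ n ≥ K, g n = g K := fun g => by
    by_cases hg : g ∈ Γ
    · obtain ⟨K, hK⟩ := H.const g hg
      exact ⟨K, fun _ => hK⟩
    · exact ⟨0, fun h => absurd h hg⟩
  have hN : ∀ g (i : ℕ), ∃ N : ℕ, g ∈ Γ → ∀ n ≥ N, ‖Ψ g n - Φ g‖ ≤ (1 / 2 : ℝ) ^ i := fun g i => by
    by_cases hg : g ∈ Γ
    · obtain ⟨N, hN⟩ := Metric.tendsto_atTop.1 (H.tendsto g hg) ((1 / 2 : ℝ) ^ i) (by positivity)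
      exact ⟨N, fun _ n hn => by rw [← dist_eq_norm]; exact (hN n hn).le⟩
    · exact ⟨0, fun h => absurd h hg⟩
  choose Kc hKc using hKc
  choose N hN using hN
  let S : (ℕ → ℕ → X) → ℕ → ℕ → X := fun s i => ∑ j ∈ Finset.range i, s j
  -- The new term must vanish until the earlier terms are constant and the agreement lengths of all
  -- partial sums so far are passed; the summand `i` makes this strictly increasing.
  let Kv : ℕ → (ℕ → ℕ → X) → ℕ := fun i s =>
    i + ∑ j ∈ Finset.range i, Kc (s j) + ∑ k ∈ Finset.range (i + 1), O (S s k) k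
  -- Beyond this index the increment along the current partial sum is within `(1 / 2) ^ i` of its
  -- limit.
  let Mv : ℕ → (ℕ → ℕ → X) → ℕ := fun i s => i + ∑ k ∈ Finset.range (i + 1), N (S s k) k
  let P : ℕ → (ℕ → ℕ → X) → (ℕ → X) → Prop := fun i s h => Q i h ∧ (∀ n ≤ Kv i s, h n = 0) ∧
    (∀ n ≤ Mv i s, ‖Ψ (S s i + h) n - Ψ (S s i) n‖ ≤ (1 / 2 : ℝ) ^ i) ∧
    (∀ n, ‖Ψ (S s i + h) n - Ψ (S s i) n - Ψ h n‖ ≤ (1 / 2 : ℝ) ^ i)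
  have hS : ∀ s i, (∀ j < i, s j ∈ Γ) → S s i ∈ Γ := fun s i h =>
    Γ.sum_mem fun j hj => h j (Finset.mem_range.1 hj)
  obtain ⟨h, hh⟩ := exists_seq_of_forall_history P (by
    intro i s s' a hss
    have e1 : ∀ k ≤ i, S s k = S s' k := fun k hk =>
      Finset.sum_congr rfl fun j hj => hss j ((Finset.mem_range.1 hj).trans_le hk)
    have e2 : Kv i s = Kv i s' := by
      simp only [Kv]
      rw [Finset.sum_congr rfl fun j hj => by rw [hss j (Finset.mem_range.1 hj)],
        Finset.sum_congr (s₁ := Finset.range (i + 1)) rfl fun j hj => by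
          rw [e1 j (Nat.lt_succ_iff.1 (Finset.mem_range.1 hj))]]
    have e3 : Mv i s = Mv i s' := by
      simp only [Mv]
      rw [Finset.sum_congr (s₁ := Finset.range (i + 1)) rfl fun j hj => by
          rw [e1 j (Nat.lt_succ_iff.1 (Finset.mem_range.1 hj))]]
    simp only [P, e1 i le_rfl, e2, e3]
    exact id) (fun g => g ∈ Γ) (by
    intro i s hs
    have hSi := hS s i hs
    have hp : (0 : ℝ) < (1 / 2 : ℝ) ^ i := by positivity
    obtain ⟨g, hg⟩ := ((hQ i).and_eventually ((eventually_tailFilter_mem Γ).and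
      ((eventually_tailFilter_eq_zero Γ (Kv i s)).and
      ((H.small _ hSi (Mv i s) _ hp).and (H.add _ hSi _ hp))))).exists
    exact ⟨g, hg.2.1, hg.1, hg.2.2.1, hg.2.2.2.1, hg.2.2.2.2⟩)
  have hmem : ∀ i, h i ∈ Γ := fun i => (hh i).1
  have hSm : ∀ i, S h i ∈ Γ := fun i => hS h i fun j _ => hmem j
  have hK : StrictMono fun i => Kv i h := by
    refine strictMono_nat_of_lt_succ fun i => ?_
    simp only [Kv]
    rw [Finset.sum_range_succ (fun j => Kc (h j)) i,
      Finset.sum_range_succ (fun k => O (S h k) k) (i + 1)]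
    omega
  have hM : StrictMono fun i => Mv i h := by
    refine strictMono_nat_of_lt_succ fun i => ?_
    simp only [Mv]
    rw [Finset.sum_range_succ (fun k => N (S h k) k) (i + 1)]
    omega
  have hzero : ∀ i, ∀ n ≤ Kv i h, h i n = 0 := fun i => (hh i).2.2.1
  -- The terms with `j ≥ n` vanish at `n`, so this is the full infinite sum.
  let w : ℕ → X := fun n => ∑ j ∈ Finset.range n, h j n
  have hw : ∀ n i, n ≤ Kv i h → w n = ∑ j ∈ Finset.range i, h j n := by
    intro n i hn
    rcases le_total n i with hni | hni
    · refine Finset.sum_subset (Finset.range_mono hni) fun j _ hj => hzero j n ?_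
      exact (not_lt.1 (Finset.mem_range.not.1 hj)).trans (hK.id_le j)
    · refine (Finset.sum_subset (Finset.range_mono hni) fun j _ hj => hzero j n ?_).symm
      exact hn.trans (hK.monotone (not_lt.1 (Finset.mem_range.not.1 hj)))
  have hwS : ∀ i, ∀ n ≤ Kv i h, w n = S h i n := fun i n hn => by
    simp only [S, Finset.sum_apply, hw n i hn]
  have hOK : ∀ k, O (S h k) k ≤ Kv k h := fun k =>
    (Finset.single_le_sum (f := fun k => O (S h k) k) (fun _ _ => Nat.zero_le _)
      (Finset.self_mem_range_succ k)).trans (Nat.le_add_left _ _)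
  have hNM : ∀ k, N (S h k) k ≤ Mv k h := fun k =>
    (Finset.single_le_sum (f := fun k => N (S h k) k) (fun _ _ => Nat.zero_le _)
      (Finset.self_mem_range_succ k)).trans (Nat.le_add_left _ _)
  have hlim := hO w (S h) hSm (fun k n hn => hwS k n (hn.trans (hOK k))) (by
    refine tendsto_pi_nhds.2 fun n => tendsto_atTop_of_eventually_const (i₀ := n) fun i hi => ?_
    exact (hwS i n (hi.trans (hK.id_le i))).symm)
  have hSs : ∀ i, S h (i + 1) = S h i + h i := fun i => Finset.sum_range_succ h i
  have hstep : ∀ i, ∀ n ≤ Mv i h, ‖Ψ (S h (i + 1)) n - Ψ (S h i) n‖ ≤ (1 / 2 : ℝ) ^ i :=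
    fun i n hn => by rw [hSs]; exact (hh i).2.2.2.1 n hn
  have hadd : ∀ i n, ‖Ψ (S h (i + 1)) n - Ψ (S h i) n - Ψ (h i) n‖ ≤ (1 / 2 : ℝ) ^ i :=
    fun i n => by rw [hSs]; exact (hh i).2.2.2.2 n
  have hpow : ∀ i : ℕ, (0 : ℝ) < (1 / 2 : ℝ) ^ i := fun i => by positivity
  have hp0 : Tendsto (fun i : ℕ => (1 / 2 : ℝ) ^ i) atTop (𝓝 0) :=
    tendsto_pow_atTop_nhds_zero_of_lt_one (by norm_num) (by norm_num)
  have hε : Tendsto (fun i : ℕ => 2 * (1 / 2 : ℝ) ^ i) atTop (𝓝 0) := by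
    simpa using hp0.const_mul 2
  -- For the interpolation lemmas, row `i` is `Ψ (S h i)`, its limit is `Φ (S h i)`, and the column
  -- limit is `Ψ w`. By `hadd`, consecutive rows differ by `Ψ (h i)` up to a null error.
  have h1 : ∀ i, ∀ n ≥ Mv i h, ‖Ψ (S h i) n - Φ (S h i)‖ ≤ 2 * (1 / 2 : ℝ) ^ i := fun i n hn =>
    (hN (S h i) i (hSm i) n ((hNM i).trans hn)).trans (by linarith [hpow i])
  have h2 : ∀ i, ∀ n ≤ Mv i h, ‖Ψ w n - Ψ (S h i) n‖ ≤ 2 * (1 / 2 : ℝ) ^ i := by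
    intro i n hn
    have ht : Tendsto (fun j => Ψ (S h (i + j)) n) atTop (𝓝 (Ψ w n)) :=
      (hlim n).comp (tendsto_add_atTop_nat i |>.congr fun j => add_comm j i)
    have hd : ∀ j, dist (Ψ (S h (i + j)) n) (Ψ (S h (i + (j + 1))) n)
        ≤ 2 * (1 / 2 : ℝ) ^ i / 2 / 2 ^ j := by
      intro j
      rw [dist_comm, dist_eq_norm]
      refine (hstep (i + j) n (hn.trans (hM.monotone (Nat.le_add_right i j)))).trans (le_of_eq ?_)
      rw [pow_add, one_div_pow 2 j]
      ring
    have := dist_le_of_le_geometric_two_of_tendsto₀ hd ht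
    rwa [dist_comm, dist_eq_norm] at this
  refine ⟨h, fun i => Kv i h, w, hmem, fun i => (hh i).2.1, hK, hzero, ?_, ?_, ?_, ?_⟩
  · intro i n hn
    have : Kc (h i) ≤ Kv (i + 1) h :=
      ((Finset.single_le_sum (f := fun j => Kc (h j)) (fun _ _ => Nat.zero_le _)
        (Finset.self_mem_range_succ i)).trans (Nat.le_add_left _ _)).trans (Nat.le_add_right _ _)
    rw [hKc (h i) (hmem i) n (this.trans hn), hKc (h i) (hmem i) _ this]
  · exact fun n m hnm => hw n m (hnm.trans (hK.id_le m))
  · rintro hwc δ hδ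
    obtain ⟨l, hl⟩ := (H.conv_iff w).2 hwc
    filter_upwards [eventually_norm_row_sub_le_of_tendsto hε hM h1 h2
      (fun i n hn => (hstep i n hn).trans (by linarith [hpow i])) hl (show 0 < δ / 2 by positivity),
      hp0.eventually_lt_const (show 0 < δ / 2 by positivity)] with i hi hi' n
    have e1 := hi n
    have e2 := hadd i n
    have : Ψ (h i) n = (Ψ (S h (i + 1)) n - Ψ (S h i) n)
      - (Ψ (S h (i + 1)) n - Ψ (S h i) n - Ψ (h i) n) := by abel
    rw [this]
    linarith [norm_sub_le (Ψ (S h (i + 1)) n - Ψ (S h i) n)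
      (Ψ (S h (i + 1)) n - Ψ (S h i) n - Ψ (h i) n)]
  · rintro ⟨l, hl⟩ hsm
    have hΦadd : ∀ i, ‖Φ (S h (i + 1)) - Φ (S h i) - Φ (h i)‖ ≤ (1 / 2 : ℝ) ^ i := fun i =>
      le_of_tendsto (((H.tendsto _ (hSm (i + 1))).sub (H.tendsto _ (hSm i))).sub
        (H.tendsto _ (hmem i))).norm (Eventually.of_forall (hadd i))
    have hc : CauchySeq fun m => Φ (S h m) - ∑ i ∈ Finset.range m, Φ (h i) := by
      refine cauchySeq_of_le_geometric (1 / 2) 1 (by norm_num) fun i => ?_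
      rw [dist_comm, dist_eq_norm, Finset.sum_range_succ, one_mul]
      have : Φ (S h (i + 1)) - (∑ i ∈ Finset.range i, Φ (h i) + Φ (h i))
        - (Φ (S h i) - ∑ i ∈ Finset.range i, Φ (h i)) = Φ (S h (i + 1)) - Φ (S h i) - Φ (h i) := by
        abel
      rw [this]
      exact hΦadd i
    obtain ⟨l', hl'⟩ := cauchySeq_tendsto_of_complete hc
    have hA : Tendsto (fun i => Φ (S h i)) atTop (𝓝 (l' + l)) := by simpa using hl'.add hl
    refine (H.conv_iff w).1 ⟨_, tendsto_of_eventually_norm_row_sub_le hε hM h1 h2 hA fun δ hδ => ?_⟩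
    filter_upwards [hsm (δ / 2) (by positivity),
      hp0.eventually_lt_const (show 0 < δ / 2 by positivity)] with i hi hi' n
    have e1 := hi n
    have e2 := hadd i n
    have : Ψ (S h (i + 1)) n - Ψ (S h i) n
      = (Ψ (S h (i + 1)) n - Ψ (S h i) n - Ψ (h i) n) + Ψ (h i) n := by abel
    rw [this]
    linarith [norm_add_le (Ψ (S h (i + 1)) n - Ψ (S h i) n - Ψ (h i) n) (Ψ (h i) n)]

end Increment

/-! ### Boundedness, the role of `c₀`, and the local additive map. -/

section Increment

variable {X Y : Type*} [NormedAddCommGroup X] [NormedAddCommGroup Y] {Γ : AddSubgroup (ℕ → X)}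
  {Ψ : (ℕ → X) → ℕ → Y} {Φ : (ℕ → X) → Y}

theorem IsIncrement.eventually_norm_limit_add_le (H : IsIncrement Γ Ψ Φ) {g : ℕ → X} (hg : g ∈ Γ)
    {ε : ℝ} (hε : 0 < ε) : ∀ᶠ h in tailFilter Γ, ‖Φ (g + h) - Φ g - Φ h‖ ≤ ε := by
  filter_upwards [H.add g hg ε hε, eventually_tailFilter_mem Γ] with h hh hhΓ
  exact le_of_tendsto (((H.tendsto _ (Γ.add_mem hg hhΓ)).sub (H.tendsto _ hg)).sub
    (H.tendsto _ hhΓ)).norm (Eventually.of_forall hh)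

/-- If it failed, late terms of sup norm at most `(1 / 2) ^ i` with increments exceeding `ε` could
be glued. Their sum converges by dominated convergence, which forces the increments to become
uniformly small. -/
theorem IsIncrement.exists_forall_norm_le [CompleteSpace X] [CompleteSpace Y]
    (H : IsIncrement Γ Ψ Φ) {ε : ℝ} (hε : 0 < ε) :
    ∃ δ > 0, ∀ᶠ h in tailFilter Γ, (∀ n, ‖h n‖ ≤ δ) → ∀ n, ‖Ψ h n‖ ≤ ε := by
  by_contra! hcon
  obtain ⟨h, K, w, -, hQ, hK, hz, hc, hw, hsm, -⟩ := H.exists_sum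
    (fun i h => (∀ n, ‖h n‖ ≤ (1 / 2 : ℝ) ^ i) ∧ ∃ n, ε < ‖Ψ h n‖)
    (fun i => by
      have := hcon ((1 / 2 : ℝ) ^ i) (by positivity)
      simpa using this)
  have hconv : Tendsto w atTop (𝓝 (∑' j, h j (K (j + 1)))) := by
    have h1 : Tendsto (fun n => ∑' j, h j n) atTop (𝓝 (∑' j, h j (K (j + 1)))) := by
      refine tendsto_tsum_of_dominated_convergence (bound := fun j => (1 / 2 : ℝ) ^ j)
        summable_geometric_two (fun j => ?_) (Eventually.of_forall fun n j => (hQ j).1 n)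
      exact tendsto_atTop_of_eventually_const (i₀ := K (j + 1)) fun n hn => hc j n hn
    refine h1.congr fun n => ?_
    rw [hw n n le_rfl, tsum_eq_sum fun j hj => hz j n
      ((not_lt.1 (Finset.mem_range.not.1 hj)).trans (hK.id_le j))]
  obtain ⟨i, hi⟩ := (hsm ⟨_, hconv⟩ ε hε).exists
  obtain ⟨n, hn⟩ := (hQ i).2
  exact absurd (hi n) (not_le.2 hn)

/-- Disjointly supported counterexamples have all finite subset sums of sup norm at most `r`, so `Φ`
of each such sum has norm at most `1`. Near additivity costs at most `∑ (1 / 2) ^ j ≤ 2`, so the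
subset sums of `Φ (h j)` are bounded by `3` and `hY` makes these terms null. The radius `r` is
chosen before `ε`. -/
theorem IsIncrement.exists_forall_norm_le_of_finite_support [CompleteSpace X] [CompleteSpace Y]
    (H : IsIncrement Γ Ψ Φ)
    (hY : ∀ y : ℕ → Y, (∃ M, ∀ F : Finset ℕ, ‖∑ i ∈ F, y i‖ ≤ M) → Tendsto y atTop (𝓝 0)) :
    ∃ r > 0, ∀ ε > 0, ∀ᶠ h in tailFilter Γ,
      (∀ᶠ n in atTop, h n = 0) → (∀ n, ‖h n‖ ≤ r) → ‖Φ h‖ ≤ ε := by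
  classical
  obtain ⟨r, hr, hA⟩ := H.exists_forall_norm_le one_pos
  obtain ⟨K0, hK0⟩ := eventually_tailFilter.1 hA
  refine ⟨r, hr, fun ε hε => ?_⟩
  by_contra! hcon
  have hZ : ∀ g : ℕ → X, ∃ K : ℕ, (∀ᶠ n in atTop, g n = 0) → ∀ n ≥ K, g n = 0 := fun g => by
    by_cases hg : ∀ᶠ n in atTop, g n = 0
    · obtain ⟨K, hK⟩ := eventually_atTop.1 hg
      exact ⟨K, fun _ => hK⟩
    · exact ⟨0, fun h => absurd h hg⟩
  choose Z hZ using hZ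
  let P : ℕ → (ℕ → ℕ → X) → (ℕ → X) → Prop := fun i s h =>
    ((∀ᶠ n in atTop, h n = 0) ∧ (∀ n, ‖h n‖ ≤ r) ∧ ε < ‖Φ h‖) ∧ (∀ n ≤ K0, h n = 0) ∧
    (∀ n ≤ ∑ j ∈ Finset.range i, Z (s j), h n = 0) ∧
    ∀ F ∈ (Finset.range i).powerset,
      ‖Φ (∑ j ∈ F, s j + h) - Φ (∑ j ∈ F, s j) - Φ h‖ ≤ (1 / 2 : ℝ) ^ i
  obtain ⟨h, hh⟩ := exists_seq_of_forall_history P (by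
    rintro i s s' a hss ⟨p1, p2, p3, p4⟩
    refine ⟨p1, p2, ?_, fun F hF => ?_⟩
    · rw [Finset.sum_congr rfl fun j hj => by rw [← hss j (Finset.mem_range.1 hj)]]
      exact p3
    · rw [Finset.sum_congr rfl fun j hj =>
        (hss j (Finset.mem_range.1 (Finset.mem_powerset.1 hF hj))).symm]
      exact p4 F hF) (fun g => g ∈ Γ) (by
    intro i s hs
    have hF : ∀ᶠ h in tailFilter Γ, ∀ F ∈ (Finset.range i).powerset,
        ‖Φ (∑ j ∈ F, s j + h) - Φ (∑ j ∈ F, s j) - Φ h‖ ≤ (1 / 2 : ℝ) ^ i :=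
      (Finset.eventually_all _).2 fun F hF => H.eventually_norm_limit_add_le
        (Γ.sum_mem fun j hj => hs j (Finset.mem_range.1 (Finset.mem_powerset.1 hF hj)))
        (by positivity)
    obtain ⟨g, hg⟩ := (hcon.and_eventually ((eventually_tailFilter_mem Γ).and
      ((eventually_tailFilter_eq_zero Γ K0).and
      ((eventually_tailFilter_eq_zero Γ (∑ j ∈ Finset.range i, Z (s j))).and hF)))).exists
    exact ⟨g, hg.2.1, hg.1, hg.2.2.1, hg.2.2.2.1, hg.2.2.2.2⟩)
  have happ : ∀ F : Finset ℕ,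
      ‖Φ (∑ j ∈ F, h j) - ∑ j ∈ F, Φ (h j)‖ ≤ ∑ j ∈ F, (1 / 2 : ℝ) ^ j := by
    intro F
    induction F using Finset.induction_on_max with
    | empty =>
      have h0 : Φ 0 = 0 := tendsto_nhds_unique (H.tendsto 0 Γ.zero_mem)
        (tendsto_const_nhds.congr fun n => (H.zero n).symm)
      simp [h0]
    | insert i F hF ih =>
      have hi : i ∉ F := fun hi => lt_irrefl _ (hF i hi)
      rw [Finset.sum_insert hi, Finset.sum_insert hi, Finset.sum_insert hi, add_comm (h i)]
      have e := (hh i).2.2.2.2 F (Finset.mem_powerset.2 fun j hj => Finset.mem_range.2 (hF j hj))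
      have : Φ (∑ j ∈ F, h j + h i) - (Φ (h i) + ∑ j ∈ F, Φ (h j))
        = (Φ (∑ j ∈ F, h j + h i) - Φ (∑ j ∈ F, h j) - Φ (h i))
          + (Φ (∑ j ∈ F, h j) - ∑ j ∈ F, Φ (h j)) := by abel
      rw [this]
      exact (norm_add_le _ _).trans (add_le_add e ih)
  have hdisj : ∀ i j n, i < j → h j n ≠ 0 → h i n = 0 := by
    intro i j n hij hj
    refine hZ (h i) (hh i).2.1.1 n ?_
    by_contra hn
    refine hj ((hh j).2.2.2.1 n ((not_le.1 hn).le.trans ?_))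
    exact Finset.single_le_sum (f := fun j => Z (h j)) (fun _ _ => Nat.zero_le _)
      (Finset.mem_range.2 hij)
  have hbd : ∀ F : Finset ℕ, ‖Φ (∑ j ∈ F, h j)‖ ≤ 1 := by
    intro F
    have hm : ∑ j ∈ F, h j ∈ Γ := Γ.sum_mem fun j _ => (hh j).1
    refine le_of_tendsto (H.tendsto _ hm).norm (Eventually.of_forall (hK0 _ hm ?_ ?_))
    · intro n hn
      rw [Finset.sum_apply]
      exact Finset.sum_eq_zero fun j _ => (hh j).2.2.1 n hn.le
    · intro n
      rw [Finset.sum_apply]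
      by_cases hex : ∃ j ∈ F, h j n ≠ 0
      · obtain ⟨j, hj, hjn⟩ := hex
        rw [Finset.sum_eq_single_of_mem j hj fun i _ hij => ?_]
        · exact (hh j).2.1.2.1 n
        · rcases lt_or_gt_of_ne hij with hlt | hgt
          · exact hdisj i j n hlt hjn
          · by_contra hi
            exact hjn (hdisj j i n hgt hi)
      · push Not at hex
        rw [Finset.sum_eq_zero hex, norm_zero]
        exact hr.le
  have hlim := hY (fun j => Φ (h j)) ⟨3, fun F => by
    have e1 : ∑ j ∈ F, (1 / 2 : ℝ) ^ j ≤ 2 := by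
      have := summable_geometric_two.sum_le_tsum F fun j _ => by positivity
      rwa [tsum_geometric_two] at this
    have : ∑ j ∈ F, Φ (h j) = Φ (∑ j ∈ F, h j) - (Φ (∑ j ∈ F, h j) - ∑ j ∈ F, Φ (h j)) := by abel
    rw [this]
    linarith [norm_sub_le (Φ (∑ j ∈ F, h j)) (Φ (∑ j ∈ F, h j) - ∑ j ∈ F, Φ (h j)), happ F, hbd F]⟩
  obtain ⟨i, hi⟩ := (Metric.tendsto_nhds.1 hlim ε hε).exists
  rw [dist_zero_right] at hi
  exact absurd hi (not_lt.2 (hh i).2.1.2.2.le)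

/-- The sequence jumping from `0` to `d` at `j`. -/
def stepSeq (d : X) (j : ℕ) : ℕ → X := fun n => if j ≤ n then d else 0

theorem tendsto_stepSeq {d : X} (hd : ∀ j, stepSeq d j ∈ Γ) :
    Tendsto (stepSeq d) atTop (tailFilter Γ) := by
  intro S hS
  obtain ⟨K, hK⟩ := eventually_tailFilter.1 (show ∀ᶠ h in tailFilter Γ, h ∈ S from hS)
  exact eventually_atTop.2 ⟨K, fun j hj => hK _ (hd j) fun n hn => if_neg (by omega)⟩

/-- The limit of the increments along later and later jumps of small height exists and is a
bounded locally additive function of the height. -/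
theorem IsIncrement.exists_local_additive [CompleteSpace X] [CompleteSpace Y]
    (H : IsIncrement Γ Ψ Φ)
    (hY : ∀ y : ℕ → Y, (∃ M, ∀ F : Finset ℕ, ‖∑ i ∈ F, y i‖ ≤ M) → Tendsto y atTop (𝓝 0))
    (D : AddSubgroup X) (hD : ∀ d ∈ D, ∀ j, stepSeq d j ∈ Γ) :
    ∃ r > 0, ∃ L : X → Y,
      (∀ u ∈ D, ‖u‖ ≤ r → Tendsto (fun j => Φ (stepSeq u j)) atTop (𝓝 (L u))) ∧
      (∀ u ∈ D, ‖u‖ ≤ r → ‖L u‖ ≤ 1) ∧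
      ∀ u ∈ D, ∀ v ∈ D, ‖u‖ ≤ r → ‖v‖ ≤ r → ‖u + v‖ ≤ r → L (u + v) = L u + L v := by
  obtain ⟨r1, hr1, hA⟩ := H.exists_forall_norm_le one_pos
  obtain ⟨r2, hr2, hC⟩ := H.exists_forall_norm_le_of_finite_support hY
  have hstep : ∀ d ∈ D, Tendsto (stepSeq d) atTop (tailFilter Γ) := fun d hd =>
    tendsto_stepSeq (hD d hd)
  have hcauchy : ∀ u ∈ D, ‖u‖ ≤ r2 → CauchySeq fun j => Φ (stepSeq u j) := by
    intro u hu hur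
    -- A step up by `u` followed by a step back is finitely supported, so its `Φ` is nearly zero.
    have hclose : ∀ ε > 0, ∃ K, ∀ j ≥ K, ∀ᶠ k in atTop,
        ‖Φ (stepSeq u j) + Φ (stepSeq (-u) k)‖ ≤ ε := by
      intro ε hε
      obtain ⟨K, hK⟩ := eventually_tailFilter.1 (hC (ε / 2) (by positivity))
      refine ⟨K, fun j hj => ?_⟩
      have hu' := D.neg_mem hu
      filter_upwards [hstep _ hu' (H.eventually_norm_limit_add_le (hD u hu j)
        (show 0 < ε / 2 by positivity)), eventually_ge_atTop j] with k hk hjk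
      have e1 : ‖Φ (stepSeq u j + stepSeq (-u) k)‖ ≤ ε / 2 := by
        refine hK _ (Γ.add_mem (hD u hu j) (hD _ hu' k)) ?_ ?_ ?_
        · intro n hn
          simp [stepSeq, show ¬ j ≤ n by omega, show ¬ k ≤ n by omega]
        · filter_upwards [eventually_ge_atTop k] with n hn
          simp [stepSeq, show j ≤ n by omega, hn]
        · intro n
          by_cases h1 : j ≤ n <;> by_cases h2 : k ≤ n <;> simp [stepSeq, h1, h2, hur, hr2.le]
      have e2 : ‖Φ (stepSeq u j + stepSeq (-u) k) - Φ (stepSeq u j) - Φ (stepSeq (-u) k)‖ ≤ ε / 2 :=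
        hk
      have : Φ (stepSeq u j) + Φ (stepSeq (-u) k) = Φ (stepSeq u j + stepSeq (-u) k)
        - (Φ (stepSeq u j + stepSeq (-u) k) - Φ (stepSeq u j) - Φ (stepSeq (-u) k)) := by abel
      rw [this]
      linarith [norm_sub_le (Φ (stepSeq u j + stepSeq (-u) k))
        (Φ (stepSeq u j + stepSeq (-u) k) - Φ (stepSeq u j) - Φ (stepSeq (-u) k))]
    refine Metric.cauchySeq_iff.2 fun ε hε => ?_
    obtain ⟨K, hK⟩ := hclose (ε / 3) (by positivity)
    refine ⟨K, fun i hi j hj => ?_⟩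
    obtain ⟨k, h1, h2⟩ := ((hK i hi).and (hK j hj)).exists
    rw [dist_eq_norm]
    have : Φ (stepSeq u i) - Φ (stepSeq u j)
      = (Φ (stepSeq u i) + Φ (stepSeq (-u) k)) - (Φ (stepSeq u j) + Φ (stepSeq (-u) k)) := by abel
    rw [this]
    linarith [norm_sub_le (Φ (stepSeq u i) + Φ (stepSeq (-u) k))
      (Φ (stepSeq u j) + Φ (stepSeq (-u) k))]
  have hL : ∀ u, ∃ l, u ∈ D → ‖u‖ ≤ r2 → Tendsto (fun j => Φ (stepSeq u j)) atTop (𝓝 l) := by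
    intro u
    by_cases hu : u ∈ D ∧ ‖u‖ ≤ r2
    · obtain ⟨l, hl⟩ := cauchySeq_tendsto_of_complete (hcauchy u hu.1 hu.2)
      exact ⟨l, fun _ _ => hl⟩
    · exact ⟨0, fun h1 h2 => absurd ⟨h1, h2⟩ hu⟩
  choose L hL using hL
  -- The staircase with successive values `u + v`, `v`, `0` is finitely supported and stays in the
  -- ball, so its `Φ` is nearly zero. Additivity of `L` follows by first taking `v = 0`, which gives
  -- oddness.
  have hzero : ∀ u ∈ D, ∀ v ∈ D, ‖u‖ ≤ r2 → ‖v‖ ≤ r2 → ‖u + v‖ ≤ r2 →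
      L (u + v) + L (-u) + L (-v) = 0 := by
    intro u hu v hv hur hvr huv
    rw [← norm_le_zero_iff]
    refine le_of_forall_pos_le_add fun ε hε => ?_
    have hu' := D.neg_mem hu
    have hv' := D.neg_mem hv
    have huv' := D.add_mem hu hv
    obtain ⟨K, hK⟩ := eventually_tailFilter.1 (hC (ε / 6) (by positivity))
    have hnear : ∀ d ∈ D, ‖d‖ ≤ r2 → ∀ᶠ j in atTop, ‖Φ (stepSeq d j) - L d‖ ≤ ε / 6 := by
      intro d hd hdr
      filter_upwards [Metric.tendsto_nhds.1 (hL d hd hdr) (ε / 6) (by positivity)] with j hj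
      rw [← dist_eq_norm]; exact hj.le
    obtain ⟨i, hi, hiK⟩ := ((hnear _ huv' huv).and (eventually_ge_atTop K)).exists
    obtain ⟨j, hj, hij, hja⟩ := ((hnear (-u) hu' (by rwa [norm_neg])).and
      ((eventually_ge_atTop i).and (hstep _ hu' (H.eventually_norm_limit_add_le (hD _ huv' i)
        (show 0 < ε / 6 by positivity))))).exists
    have hm := Γ.add_mem (hD _ huv' i) (hD _ hu' j)
    obtain ⟨k, hk, hjk, hka⟩ := ((hnear (-v) hv' (by rwa [norm_neg])).and
      ((eventually_ge_atTop j).and (hstep _ hv' (H.eventually_norm_limit_add_le hm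
        (show 0 < ε / 6 by positivity))))).exists
    have e0 : ‖Φ (stepSeq (u + v) i + stepSeq (-u) j + stepSeq (-v) k)‖ ≤ ε / 6 := by
      refine hK _ (Γ.add_mem hm (hD _ hv' k)) ?_ ?_ ?_
      · intro n hn
        simp [stepSeq, show ¬ i ≤ n by omega, show ¬ j ≤ n by omega, show ¬ k ≤ n by omega]
      · filter_upwards [eventually_ge_atTop k] with n hn
        simp [stepSeq, show i ≤ n by omega, show j ≤ n by omega, hn]
      · intro n
        by_cases h1 : i ≤ n
        · by_cases h2 : j ≤ n
          · by_cases h3 : k ≤ n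
            · simp [stepSeq, h1, h2, h3, hr2.le]
            · simpa [stepSeq, h1, h2, h3] using hvr
          · simpa [stepSeq, h1, h2, show ¬ k ≤ n by omega] using huv
        · simp [stepSeq, h1, show ¬ j ≤ n by omega, show ¬ k ≤ n by omega, hr2.le]
    have e1 : ‖Φ (stepSeq (u + v) i + stepSeq (-u) j) - Φ (stepSeq (u + v) i)
      - Φ (stepSeq (-u) j)‖ ≤ ε / 6 := hja
    have e2 : ‖Φ (stepSeq (u + v) i + stepSeq (-u) j + stepSeq (-v) k)
      - Φ (stepSeq (u + v) i + stepSeq (-u) j) - Φ (stepSeq (-v) k)‖ ≤ ε / 6 := hka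
    generalize Φ (stepSeq (u + v) i + stepSeq (-u) j + stepSeq (-v) k) = a at *
    generalize Φ (stepSeq (u + v) i + stepSeq (-u) j) = b at *
    generalize Φ (stepSeq (u + v) i) = c at *
    generalize Φ (stepSeq (-u) j) = d at *
    generalize Φ (stepSeq (-v) k) = e at *
    have : L (u + v) + L (-u) + L (-v) = a - (a - b - e) - (b - c - d) - (c - L (u + v))
      - (d - L (-u)) - (e - L (-v)) := by abel
    rw [this, zero_add]
    linarith [norm_sub_le (a - (a - b - e) - (b - c - d) - (c - L (u + v)) - (d - L (-u)))
        (e - L (-v)), norm_sub_le (a - (a - b - e) - (b - c - d) - (c - L (u + v))) (d - L (-u)),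
      norm_sub_le (a - (a - b - e) - (b - c - d)) (c - L (u + v)),
      norm_sub_le (a - (a - b - e)) (b - c - d), norm_sub_le a (a - b - e)]
  have h00 : L 0 = 0 := by
    have h0 : Φ 0 = 0 := tendsto_nhds_unique (H.tendsto 0 Γ.zero_mem)
      (tendsto_const_nhds.congr fun n => (H.zero n).symm)
    have hs : ∀ j, stepSeq (0 : X) j = 0 := fun j => by funext n; simp [stepSeq]
    refine tendsto_nhds_unique (hL 0 D.zero_mem (by simpa using hr2.le)) ?_
    simp [hs, h0]
  have hneg : ∀ u ∈ D, ‖u‖ ≤ r2 → L (-u) = -L u := by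
    intro u hu hur
    have := hzero u hu 0 D.zero_mem hur (by simpa using hr2.le) (by simpa using hur)
    rw [add_zero, neg_zero, h00, add_zero] at this
    exact (neg_eq_of_add_eq_zero_right this).symm
  refine ⟨min r1 r2, lt_min hr1 hr2, L, fun u hu hur => hL u hu (hur.trans (min_le_right _ _)),
    fun u hu hur => ?_, fun u hu v hv hur hvr huv => ?_⟩
  · refine le_of_tendsto (hL u hu (hur.trans (min_le_right _ _))).norm ?_
    filter_upwards [hstep u hu hA] with j hj
    refine le_of_tendsto (H.tendsto _ (hD u hu j)).norm (Eventually.of_forall (hj fun n => ?_))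
    by_cases h : j ≤ n <;> simp [stepSeq, h, hr1.le, hur.trans (min_le_left _ _)]
  · have hur' := hur.trans (min_le_right _ _)
    have hvr' := hvr.trans (min_le_right _ _)
    have := hzero u hu v hv hur' hvr' (huv.trans (min_le_right _ _))
    rw [hneg u hu hur', hneg v hv hvr', add_assoc, ← neg_add] at this
    exact add_neg_eq_zero.1 this

end Increment

/-! ### From a local additive map to a linear map bounded below. -/

section Extension

variable {X Y : Type*} [NormedAddCommGroup X] [NormedSpace ℝ X] [NormedAddCommGroup Y]
  [NormedSpace ℝ Y]

/-- A bounded additive map on a dense subgroup extends to a continuous linear map. -/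
theorem AddMonoidHom.exists_continuousLinearMap_extension [CompleteSpace Y] (D : AddSubgroup X)
    (hD : Dense (D : Set X)) (T : D →+ Y) (M : ℝ) (hT : ∀ d : D, ‖T d‖ ≤ M * ‖(d : X)‖) :
    ∃ S : X →L[ℝ] Y, ∀ d : D, S d = T d := by
  have hui : IsUniformInducing ((↑) : D → X) := isUniformInducing_val _
  have hdr : DenseRange ((↑) : D → X) := by
    rw [DenseRange, Subtype.range_coe_subtype]; exact hD
  have hTu : UniformContinuous T := by
    refine (AddMonoidHomClass.lipschitz_of_bound (E := D) T M fun d => ?_).uniformContinuous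
    exact hT d
  let S : X → Y := (hui.isDenseInducing hdr).extend T
  have hSu : UniformContinuous S := uniformContinuous_uniformly_extend hui hdr hTu
  have hS : ∀ d : D, S d = T d := fun d => uniformly_extend_of_ind hui hdr hTu d
  have hadd : ∀ x y, S (x + y) = S x + S y := by
    intro x y
    have := isClosed_property2 (p := fun a b => S (a + b) = S a + S b) hdr
      (isClosed_eq (hSu.continuous.comp (continuous_fst.add continuous_snd))
        ((hSu.continuous.comp continuous_fst).add (hSu.continuous.comp continuous_snd)))
      (fun a b => by rw [← AddSubgroup.coe_add, hS, hS, hS, map_add])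
    exact this x y
  exact ⟨(AddMonoidHom.mk' S hadd).toRealLinearMap hSu.continuous, hS⟩

/-- The global map is `n • L (n⁻¹ • x)` for any `n` large enough to bring `n⁻¹ • x` into the ball;
two scales are compared through their product. -/
theorem exists_continuousLinearMap_of_local_additive [CompleteSpace Y] (D : AddSubgroup X)
    (hD : Dense (D : Set X)) (hDq : ∀ q : ℚ, ∀ d ∈ D, (q : ℝ) • d ∈ D) {r : ℝ} (hr : 0 < r)
    (L : X → Y) (hL : ∀ u ∈ D, ‖u‖ ≤ r → ‖L u‖ ≤ 1)
    (hadd : ∀ u ∈ D, ∀ v ∈ D, ‖u‖ ≤ r → ‖v‖ ≤ r → ‖u + v‖ ≤ r → L (u + v) = L u + L v) :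
    ∃ S : X →L[ℝ] Y, ∀ u ∈ D, ‖u‖ ≤ r → S u = L u := by
  have hL0 : L 0 = 0 := by
    have := hadd 0 D.zero_mem 0 D.zero_mem (by simpa using hr.le) (by simpa using hr.le)
      (by simpa using hr.le)
    rw [add_zero] at this
    exact left_eq_add.1 this
  have hDn : ∀ n : ℕ, ∀ d ∈ D, (n : ℝ) • d ∈ D := fun n d hd => by
    simpa using hDq n d hd
  have hDi : ∀ n : ℕ, ∀ d ∈ D, (n : ℝ)⁻¹ • d ∈ D := fun n d hd => by
    simpa using hDq (n : ℚ)⁻¹ d hd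
  have hsmul : ∀ n : ℕ, ∀ u ∈ D, n * ‖u‖ ≤ r → L ((n : ℝ) • u) = (n : ℝ) • L u := by
    intro n u hu
    induction n with
    | zero => simp [hL0]
    | succ n ih =>
      intro h
      push_cast at h ⊢
      have h0 := norm_nonneg u
      have h1 : (n : ℝ) * ‖u‖ ≤ r := by nlinarith
      have h2 : ‖u‖ ≤ r := by nlinarith [(Nat.cast_nonneg n : (0 : ℝ) ≤ n), mul_nonneg (Nat.cast_nonneg n : (0 : ℝ) ≤ n) h0]
      rw [add_smul, add_smul, one_smul, one_smul, hadd _ (hDn n u hu) u hu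
        (by rw [norm_smul, Real.norm_natCast]; exact h1) h2, ih h1]
      rw [show (n : ℝ) • u + u = ((n : ℝ) + 1) • u by rw [add_smul, one_smul], norm_smul,
        Real.norm_of_nonneg (by positivity)]
      exact h
  have hsc : ∀ n : ℕ, 0 < n → ∀ x : X, ‖x‖ ≤ n * r → ‖(n : ℝ)⁻¹ • x‖ ≤ r := by
    intro n hn x hx
    have hn' : (0 : ℝ) < n := Nat.cast_pos.2 hn
    rw [norm_smul, norm_inv, Real.norm_natCast, inv_mul_le_iff₀ hn']
    exact hx
  have hind0 : ∀ m n : ℕ, 0 < m → 0 < n → ∀ x ∈ D, ‖x‖ ≤ n * r →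
      (n : ℝ) • L ((n : ℝ)⁻¹ • x) = (n : ℝ) • (m : ℝ) • L ((m : ℝ)⁻¹ • (n : ℝ)⁻¹ • x) := by
    intro m n hm hn x hx hxn
    have hm' : (m : ℝ) ≠ 0 := Nat.cast_ne_zero.2 hm.ne'
    rw [← hsmul m _ (hDi m _ (hDi n x hx)), smul_inv_smul₀ hm']
    rw [norm_smul, norm_inv, Real.norm_natCast, mul_inv_cancel_left₀ hm']
    exact hsc n hn x hxn
  have hind : ∀ m n : ℕ, 0 < m → 0 < n → ∀ x ∈ D, ‖x‖ ≤ m * r → ‖x‖ ≤ n * r →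
      (m : ℝ) • L ((m : ℝ)⁻¹ • x) = (n : ℝ) • L ((n : ℝ)⁻¹ • x) := by
    intro m n hm hn x hx hxm hxn
    rw [hind0 m n hm hn x hx hxn, hind0 n m hn hm x hx hxm, smul_comm (m : ℝ) (n : ℝ),
      smul_comm (m : ℝ)⁻¹ (n : ℝ)⁻¹]
  let N : X → ℕ := fun x => ⌈‖x‖ / r⌉₊ + 1
  have hN : ∀ x, ‖x‖ ≤ N x * r := by
    intro x
    have h1 := Nat.le_ceil (‖x‖ / r)
    rw [div_le_iff₀ hr] at h1
    have : (N x : ℝ) = (⌈‖x‖ / r⌉₊ : ℝ) + 1 := by simp [N]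
    rw [this]
    linarith
  have hN0 : ∀ x, 0 < N x := fun x => Nat.succ_pos _
  have hNle : ∀ x, (N x : ℝ) ≤ ‖x‖ / r + 2 := by
    intro x
    have h1 := (Nat.ceil_lt_add_one (div_nonneg (norm_nonneg x) hr.le)).le
    have : (N x : ℝ) = (⌈‖x‖ / r⌉₊ : ℝ) + 1 := by simp [N]
    rw [this]
    linarith
  let T0 : D → Y := fun x => (N x : ℝ) • L ((N x : ℝ)⁻¹ • (x : X))
  have hT0 : ∀ (x : D) (n : ℕ), 0 < n → ‖(x : X)‖ ≤ n * r → T0 x = (n : ℝ) • L ((n : ℝ)⁻¹ • (x : X)) :=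
    fun x n hn hx => hind _ n (hN0 x) hn x x.2 (hN x) hx
  have hTadd : ∀ x y : D, T0 (x + y) = T0 x + T0 y := by
    intro x y
    have hle : ∀ a b : ℕ, (a : ℝ) * r ≤ ((a + b : ℕ) : ℝ) * r := fun a b => by
      push_cast
      nlinarith [(Nat.cast_nonneg b : (0 : ℝ) ≤ b)]
    have hx := (hN x).trans (hle (N x) (N y))
    have hy : ‖(y : X)‖ ≤ ((N x + N y : ℕ) : ℝ) * r := (hN y).trans (by
      rw [add_comm (N x)]; exact hle _ _)
    have hxy : ‖((x + y : D) : X)‖ ≤ ((N x + N y : ℕ) : ℝ) * r := by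
      push_cast
      rw [add_mul]
      exact (norm_add_le _ _).trans (add_le_add (hN x) (hN y))
    have hp : 0 < N x + N y := Nat.add_pos_left (hN0 x) _
    rw [hT0 _ _ hp hx, hT0 _ _ hp hy, hT0 _ _ hp hxy, ← smul_add, ← hadd _ (hDi _ _ x.2) _ (hDi _ _ y.2)
      (hsc _ hp _ hx) (hsc _ hp _ hy), ← smul_add, AddSubgroup.coe_add]
    rw [← smul_add]
    exact hsc _ hp _ hxy
  let T : D →+ Y := AddMonoidHom.mk' T0 hTadd
  have hTb : ∀ x : D, ‖T x‖ ≤ ‖(x : X)‖ / r + 2 := by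
    intro x
    refine le_trans ?_ (hNle x)
    change ‖(N x : ℝ) • L ((N x : ℝ)⁻¹ • (x : X))‖ ≤ _
    rw [norm_smul, Real.norm_natCast]
    exact mul_le_of_le_one_right (Nat.cast_nonneg _) (hL _ (hDi _ _ x.2) (hsc _ (hN0 x) _ (hN x)))
  -- The additive constant `2` disappears on applying the bound to `k • x` with `k` large.
  have hTb' : ∀ x : D, ‖T x‖ ≤ r⁻¹ * ‖(x : X)‖ := by
    intro x
    by_contra! hlt
    obtain ⟨k, hk⟩ := exists_nat_gt (2 / (‖T x‖ - r⁻¹ * ‖(x : X)‖))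
    rw [div_lt_iff₀ (by linarith)] at hk
    have h1 := hTb (k • x)
    rw [map_nsmul, AddSubgroup.coe_nsmul, ← Nat.cast_smul_eq_nsmul ℝ, ← Nat.cast_smul_eq_nsmul ℝ,
      norm_smul, norm_smul, Real.norm_natCast, mul_div_assoc, div_eq_inv_mul] at h1
    linarith
  obtain ⟨S, hS⟩ := AddMonoidHom.exists_continuousLinearMap_extension D hD T _ hTb'
  refine ⟨S, fun u hu hur => ?_⟩
  have := hT0 ⟨u, hu⟩ 1 one_pos (by simpa using hur)
  rw [hS ⟨u, hu⟩]
  change T0 ⟨u, hu⟩ = L u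
  simpa using this

/-- A continuous linear map is bounded below if it reflects convergence of sequences whose steps
are small multiples of elements of a dense set and tend to zero. -/
theorem ContinuousLinearMap.exists_le_norm_of_reflects_convergence (D : AddSubgroup X)
    (hD : Dense (D : Set X)) (hDq : ∀ q : ℚ, ∀ d ∈ D, (q : ℝ) • d ∈ D) (S : X →L[ℝ] Y)
    {r : ℝ} (hr : 0 < r)
    (hS : ∀ p : ℕ → X, (∀ n, p n ∈ D) → p 0 = 0 → (∀ n, ‖p (n + 1) - p n‖ ≤ r) →
      Tendsto (fun n => p (n + 1) - p n) atTop (𝓝 0) →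
      (∃ l, Tendsto (fun n => S (p n)) atTop (𝓝 l)) → ∃ l, Tendsto p atTop (𝓝 l)) :
    ∃ c > 0, ∀ x, c * ‖x‖ ≤ ‖S x‖ := by
  by_contra! hcon
  -- Failure of the lower bound is an open condition, so it is witnessed in `D`; a rational multiple
  -- then has norm between `r / 2` and `r`.
  have hu : ∀ i : ℕ, ∃ u ∈ D, r / 2 ≤ ‖u‖ ∧ ‖u‖ ≤ r ∧ ‖S u‖ ≤ 1 / ((i : ℝ) + 1) := by
    intro i
    have hc : (0 : ℝ) < 1 / (((i : ℝ) + 1) * r) := by positivity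
    have hopen : IsOpen {x : X | ‖S x‖ < 1 / (((i : ℝ) + 1) * r) * ‖x‖} :=
      isOpen_lt (by fun_prop) (by fun_prop)
    obtain ⟨x, hx⟩ := hcon _ hc
    obtain ⟨d, hd, hdD⟩ := hD.inter_open_nonempty _ hopen ⟨x, hx⟩
    have hd' : ‖S d‖ < 1 / (((i : ℝ) + 1) * r) * ‖d‖ := hd
    have hd0 : 0 < ‖d‖ := by
      rcases (norm_nonneg d).eq_or_lt with h | h
      · rw [← h, mul_zero] at hd'
        exact absurd hd' (not_lt.2 (norm_nonneg _))
      · exact h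
    obtain ⟨q, hq1, hq2⟩ := exists_rat_btwn
      (show r / 2 / ‖d‖ < r / ‖d‖ from div_lt_div_of_pos_right (by linarith) hd0)
    have hq0 : (0 : ℝ) < q := lt_trans (by positivity) hq1
    rw [div_lt_iff₀ hd0] at hq1
    rw [lt_div_iff₀ hd0] at hq2
    have hn : ‖(q : ℝ) • d‖ = q * ‖d‖ := by rw [norm_smul, Real.norm_of_nonneg hq0.le]
    refine ⟨(q : ℝ) • d, hDq q d hdD, by rw [hn]; exact hq1.le, by rw [hn]; exact hq2.le, ?_⟩
    rw [map_smul, norm_smul, Real.norm_of_nonneg hq0.le]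
    calc (q : ℝ) * ‖S d‖ ≤ q * (1 / (((i : ℝ) + 1) * r) * ‖d‖) := by gcongr
      _ = (1 / (((i : ℝ) + 1) * r)) * (q * ‖d‖) := by ring
      _ ≤ (1 / (((i : ℝ) + 1) * r)) * r := by gcongr
      _ = 1 / ((i : ℝ) + 1) := by field_simp
  choose u huD hu1 hu2 hu3 using hu
  -- Writing `m = i * i + k` with `k ≤ 2 * i`, the walk runs during block `i` from `0` to `u i` and
  -- back in steps of size at most `r / i`. At `i = 0` division by zero gives the value `0`.
  let c : ℕ → ℕ → ℚ := fun i k => (min k (2 * i - k) : ℕ) / (i : ℚ)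
  let p : ℕ → X := fun m => ((c m.sqrt (m - m.sqrt * m.sqrt) : ℚ) : ℝ) • u m.sqrt
  have hp : ∀ i k, k ≤ 2 * i → p (i * i + k) = ((c i k : ℚ) : ℝ) • u i := by
    intro i k hk
    have h1 : (i * i + k).sqrt = i := Nat.sqrt_add_eq i (by omega)
    simp only [p, h1, Nat.add_sub_cancel_left]
  have hdec : ∀ m : ℕ, ∃ k ≤ 2 * m.sqrt, m = m.sqrt * m.sqrt + k := fun m => by
    have h1 := Nat.sqrt_le m
    have h2 := Nat.sqrt_le_add m
    exact ⟨m - m.sqrt * m.sqrt, by omega, by omega⟩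
  have hc0 : ∀ i k, (0 : ℝ) ≤ ((c i k : ℚ) : ℝ) := fun i k => by
    simp only [c]; push_cast; positivity
  have hc1 : ∀ i k, ((c i k : ℚ) : ℝ) ≤ 1 := fun i k => by
    have h : min k (2 * i - k) ≤ i := by omega
    have h' : ((min k (2 * i - k) : ℕ) : ℝ) ≤ i := by exact_mod_cast h
    simp only [c]
    push_cast at h' ⊢
    exact div_le_one_of_le₀ h' (Nat.cast_nonneg i)
  have hstep : ∀ m, ‖p (m + 1) - p m‖ ≤ r / m.sqrt ∧ ‖p (m + 1) - p m‖ ≤ r := by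
    intro m
    obtain ⟨k, hk, hm⟩ := hdec m
    set i := m.sqrt
    rcases hk.eq_or_lt with rfl | hk'
    · have h1 : m + 1 = (i + 1) * (i + 1) + 0 := by rw [hm]; ring
      rw [h1, hp _ _ (Nat.zero_le _), hm, hp _ _ le_rfl]
      simp only [c]
      simp only [Nat.sub_self, Nat.zero_min, Nat.min_zero, Nat.cast_zero, zero_div, Rat.cast_zero,
        zero_smul, sub_zero, norm_zero]
      exact ⟨by positivity, hr.le⟩
    · have hi : 1 ≤ i := by omega
      have hi' : (1 : ℝ) ≤ i := by exact_mod_cast hi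
      have h1 : m + 1 = i * i + (k + 1) := by omega
      have hdiff : |((c i (k + 1) : ℚ) : ℝ) - ((c i k : ℚ) : ℝ)| ≤ 1 / i := by
        simp only [c]
        push_cast
        rw [← sub_div, abs_div, abs_of_nonneg (zero_le_one.trans hi')]
        refine div_le_div_of_nonneg_right ?_ (zero_le_one.trans hi')
        rw [← Nat.cast_succ, ← Nat.cast_min, ← Nat.cast_min, abs_le]
        have h2 : min k (2 * i - k) ≤ min (k + 1) (2 * i - (k + 1)) + 1 := by omega
        have h3 : min (k + 1) (2 * i - (k + 1)) ≤ min k (2 * i - k) + 1 := by omega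
        have h2' : ((min k (2 * i - k) : ℕ) : ℝ) ≤ (min (k + 1) (2 * i - (k + 1)) : ℕ) + 1 := by
          exact_mod_cast h2
        have h3' : ((min (k + 1) (2 * i - (k + 1)) : ℕ) : ℝ) ≤ (min k (2 * i - k) : ℕ) + 1 := by
          exact_mod_cast h3
        constructor <;> linarith
      have hmain : ‖p (m + 1) - p m‖ ≤ r / i := by
        rw [h1, hp _ _ (by omega), hm, hp _ _ hk, ← sub_smul, norm_smul, Real.norm_eq_abs]
        calc _ ≤ 1 / (i : ℝ) * r := mul_le_mul hdiff (hu2 i) (norm_nonneg _) (by positivity)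
          _ = r / i := by ring
      exact ⟨hmain, hmain.trans (div_le_self hr.le hi')⟩
  have hsq : Tendsto Nat.sqrt atTop atTop :=
    tendsto_atTop.2 fun b => eventually_atTop.2 ⟨b * b, fun m hm => Nat.le_sqrt.2 hm⟩
  have hsqR : Tendsto (fun m : ℕ => (m.sqrt : ℝ)) atTop atTop :=
    tendsto_natCast_atTop_atTop.comp hsq
  obtain ⟨l, hl⟩ := hS p (fun n => hDq _ _ (huD _)) (by simp [p, c]) (fun m => (hstep m).2)
    (squeeze_zero_norm (fun m => (hstep m).1) (hsqR.const_div_atTop r)) ⟨0, by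
      refine squeeze_zero_norm (fun m => ?_)
        (tendsto_one_div_add_atTop_nhds_zero_nat.comp hsq)
      rw [map_smul, norm_smul, Real.norm_of_nonneg (hc0 _ _)]
      exact (mul_le_of_le_one_left (norm_nonneg _) (hc1 _ _)).trans (hu3 _)⟩
  -- The walk is at `0` at time `i * i` and at `u i` at time `i * i + i`, so its convergence
  -- contradicts `r / 2 ≤ ‖u i‖`.
  have hii : Tendsto (fun i : ℕ => i * i) atTop atTop :=
    tendsto_atTop_mono (fun i => Nat.le_mul_self i) tendsto_id
  have ht1 : Tendsto (fun i : ℕ => p (i * i + 0)) atTop (𝓝 l) := hl.comp hii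
  have ht2 : Tendsto (fun i : ℕ => p (i * i + i)) atTop (𝓝 l) :=
    hl.comp (tendsto_atTop_mono (fun i => Nat.le_add_right (i * i) i) hii)
  have h3 := ((ht2.sub ht1).norm).congr' (f₂ := fun i => ‖u i‖) (by
    filter_upwards [eventually_ge_atTop 1] with i hi
    have hi' : (i : ℚ) ≠ 0 := by exact_mod_cast (show i ≠ 0 by omega)
    have e1 : c i i = 1 := by
      simp only [c]
      rw [show min i (2 * i - i) = i by omega, div_self hi']
    have e2 : c i 0 = 0 := by simp [c]
    rw [hp _ _ (by omega), hp _ _ (by omega), e1, e2]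
    simp)
  rw [sub_self, norm_zero] at h3
  have := ge_of_tendsto' h3 hu1
  linarith

end Extension

/-! ### The countable groups of values and of sequences. -/

section Subgroups

variable (X : Type*) [NormedAddCommGroup X]

theorem exists_countable_dense_addSubgroup_rat [NormedSpace ℝ X]
    [TopologicalSpace.SeparableSpace X] :
    ∃ D : AddSubgroup X, Countable D ∧ Dense (D : Set X) ∧ ∀ q : ℚ, ∀ d ∈ D, (q : ℝ) • d ∈ D := by
  let u := TopologicalSpace.denseSeq X
  let T : (ℕ →₀ ℚ) →+ X := Finsupp.liftAddHom fun i =>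
    { toFun := fun q => (q : ℝ) • u i
      map_zero' := by simp
      map_add' := fun a b => by rw [Rat.cast_add, add_smul] }
  refine ⟨T.range, ?_, ?_, ?_⟩
  · exact (Set.countable_range T).to_subtype
  · refine (TopologicalSpace.denseRange_denseSeq X).mono ?_
    rintro _ ⟨i, rfl⟩
    exact ⟨Finsupp.single i 1, by simp [T, u]⟩
  · rintro q _ ⟨c, rfl⟩
    refine ⟨c.mapRange (fun x => q * x) (by simp), ?_⟩
    simp only [T, Finsupp.liftAddHom_apply, AddMonoidHom.coe_mk, ZeroHom.coe_mk]
    rw [Finsupp.sum_mapRange_index (by simp), Finsupp.smul_sum]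
    simp [mul_smul]

variable {X}

/-- The eventually constant sequences with values in a subgroup. -/
def eventuallyConstSeq (D : AddSubgroup X) : AddSubgroup (ℕ → X) where
  carrier := {h | (∀ n, h n ∈ D) ∧ ∃ K, ∀ n ≥ K, h n = h K}
  zero_mem' := ⟨fun _ => D.zero_mem, 0, fun _ _ => rfl⟩
  add_mem' := by
    rintro a b ⟨ha, K, hK⟩ ⟨hb, K', hK'⟩
    refine ⟨fun n => D.add_mem (ha n) (hb n), max K K', fun n hn => ?_⟩
    simp only [Pi.add_apply]
    rw [hK n (by omega), hK' n (by omega), hK (max K K') (by omega), hK' (max K K') (by omega)]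
  neg_mem' := by
    rintro a ⟨ha, K, hK⟩
    exact ⟨fun n => D.neg_mem (ha n), K, fun n hn => congrArg Neg.neg (hK n hn)⟩

theorem mem_eventuallyConstSeq {D : AddSubgroup X} {h : ℕ → X} :
    h ∈ eventuallyConstSeq D ↔ (∀ n, h n ∈ D) ∧ ∃ K, ∀ n ≥ K, h n = h K := Iff.rfl

theorem stepSeq_mem_eventuallyConstSeq {D : AddSubgroup X} {d : X} (hd : d ∈ D) (j : ℕ) :
    stepSeq d j ∈ eventuallyConstSeq D := by
  refine mem_eventuallyConstSeq.2 ⟨fun n => ?_, j, fun n hn => by simp [stepSeq, show j ≤ n from hn]⟩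
  by_cases h : j ≤ n <;> simp [stepSeq, h, hd, D.zero_mem]

theorem countable_eventuallyConstSeq (D : AddSubgroup X) [Countable D] :
    Countable (eventuallyConstSeq D) := by
  -- A sequence is coded by its initial values and its eventual value, the latter serving as the
  -- default of `getD`.
  let F : List D × D → (ℕ → X) := fun p n => ((p.1.getD n p.2 : D) : X)
  refine Set.Countable.to_subtype ((Set.countable_range F).mono ?_)
  rintro h ⟨hD, K, hK⟩
  refine ⟨((List.range K).map fun n => ⟨h n, hD n⟩, ⟨h K, hD K⟩), ?_⟩
  funext n
  by_cases hn : n < K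
  · simp [F, List.getD, hn]
  · simp [F, List.getD, hn, hK n (not_lt.1 hn)]

end Subgroups

/-! ### Reductions versus embeddings. -/

section Embedding

variable {X Y : Type*} [NormedAddCommGroup X] [NormedSpace ℝ X] [NormedAddCommGroup Y]
  [NormedSpace ℝ Y]

theorem isoToClosedSubspace_of_le_norm [CompleteSpace X] (S : X →L[ℝ] Y) {c : ℝ} (hc : 0 < c)
    (hS : ∀ x, c * ‖x‖ ≤ ‖S x‖) : IsoToClosedSubspace X Y := by
  have hinj : Function.Injective S := by
    refine (injective_iff_map_eq_zero S).2 fun x hx => ?_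
    have := hS x
    rw [hx, norm_zero] at this
    exact norm_le_zero_iff.1 (nonpos_of_mul_nonpos_right this hc)
  have hanti : AntilipschitzWith (Real.toNNReal c⁻¹) S := by
    refine AddMonoidHomClass.antilipschitz_of_bound S fun x => ?_
    rw [Real.coe_toNNReal _ (inv_nonneg.2 hc.le), ← div_eq_inv_mul, le_div_iff₀ hc, mul_comm]
    exact hS x
  refine ⟨LinearMap.range (S : X →ₗ[ℝ] Y), ?_, ⟨?_⟩⟩
  · exact hanti.isClosed_range S.uniformContinuous
  · let e := LinearEquiv.ofInjective (S : X →ₗ[ℝ] Y) hinj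
    refine LinearEquiv.toContinuousLinearEquivOfBounds e ‖S‖ c⁻¹ (fun x => S.le_opNorm x) fun y => ?_
    have := hS (e.symm y)
    have h2 : S (e.symm y) = y := congrArg Subtype.val (e.apply_symm_apply y)
    rw [h2] at this
    rw [← div_eq_inv_mul, le_div_iff₀ hc, mul_comm]
    exact this

/-- A Borel reduction of `E(X)` to `E(Y)` yields an isomorphic embedding of `X` into `Y` if
bounded subset sums in `Y` have null terms. -/
theorem isoToClosedSubspace_of_borelReducible [CompleteSpace X]
    [TopologicalSpace.SeparableSpace X] [CompleteSpace Y] [TopologicalSpace.SeparableSpace Y]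
    (hY : ∀ y : ℕ → Y, (∃ M, ∀ F : Finset ℕ, ‖∑ i ∈ F, y i‖ ≤ M) → Tendsto y atTop (𝓝 0))
    (hred : BorelReducible (inducedEquivRel X) (inducedEquivRel Y)) :
    IsoToClosedSubspace X Y := by
  have := UniformSpace.secondCountable_of_separable X
  have := UniformSpace.secondCountable_of_separable Y
  obtain ⟨D, hDc, hDd, hDq⟩ := exists_countable_dense_addSubgroup_rat X
  have := countable_eventuallyConstSeq D
  obtain ⟨Ψ, Φ, H⟩ := exists_isIncrement hred (eventuallyConstSeq D) fun g hg => hg.2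
  obtain ⟨r, hr, L, hL, hLb, hLadd⟩ := H.exists_local_additive hY D
    fun d hd j => stepSeq_mem_eventuallyConstSeq hd j
  obtain ⟨S, hS⟩ := exists_continuousLinearMap_of_local_additive D hDd hDq hr L hLb hLadd
  obtain ⟨c, hc, hcS⟩ := S.exists_le_norm_of_reflects_convergence D hDd hDq hr (by
    rintro p hpD hp0 hpr hp ⟨l, hl⟩
    have hdD : ∀ n, p (n + 1) - p n ∈ D := fun n => D.sub_mem (hpD _) (hpD _)
    -- Steps of heights `p (i + 1) - p i` are placed so late that `Φ` is nearly `S` on them; their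
    -- sum `w` then passes through `p m` at time `K m`.
    obtain ⟨h, K, w, hΓ, hQ, hK, hz, hcst, hw, -, hconv⟩ := H.exists_sum
      (fun i h => (∃ j, h = stepSeq (p (i + 1) - p i) j) ∧
        ‖Φ h - S (p (i + 1) - p i)‖ ≤ (1 / 2 : ℝ) ^ i) (fun i => by
        have h1 : ∃ᶠ j in atTop, ‖Φ (stepSeq (p (i + 1) - p i) j) - S (p (i + 1) - p i)‖
            ≤ (1 / 2 : ℝ) ^ i := by
          refine Eventually.frequently ?_
          rw [hS _ (hdD i) (hpr i)]
          filter_upwards [Metric.tendsto_nhds.1 (hL _ (hdD i) (hpr i)) ((1 / 2 : ℝ) ^ i)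
            (by positivity)] with j hj
          rw [← dist_eq_norm]; exact hj.le
        exact (tendsto_stepSeq fun j => stepSeq_mem_eventuallyConstSeq (hdD i) j).frequently
          (h1.mono fun j hj => ⟨⟨j, rfl⟩, hj⟩))
    have hval : ∀ i, ∀ n ≥ K (i + 1), h i n = p (i + 1) - p i := by
      intro i n hn
      obtain ⟨j, hj⟩ := (hQ i).1
      rw [hcst i n hn, ← hcst i (max (K (i + 1)) j) (le_max_left _ _), hj]
      simp [stepSeq]
    have hwK : ∀ m, w (K m) = p m := by
      intro m
      have h1 : ∑ j ∈ Finset.range m, h j (K m) = p m := by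
        rw [Finset.sum_congr rfl fun j hj => hval j (K m)
          (hK.monotone (Finset.mem_range.1 hj)), Finset.sum_range_sub, hp0, sub_zero]
      rw [hw (K m) (K m) le_rfl, ← h1]
      refine (Finset.sum_subset (Finset.range_mono (hK.id_le m)) fun j _ hj => hz j _ ?_).symm
      exact hK.monotone (not_lt.1 (Finset.mem_range.not.1 hj))
    -- The errors are summable, so convergence of `S (p m)` passes to the sums of `Φ (h i)`.
    have hcauchy : CauchySeq fun m => ∑ i ∈ Finset.range m, Φ (h i) - S (p m) := by
      refine cauchySeq_of_le_geometric (1 / 2) 1 (by norm_num) fun i => ?_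
      rw [dist_comm, dist_eq_norm, Finset.sum_range_succ, one_mul]
      have : ∑ i ∈ Finset.range i, Φ (h i) + Φ (h i) - S (p (i + 1))
        - (∑ i ∈ Finset.range i, Φ (h i) - S (p i)) = Φ (h i) - S (p (i + 1) - p i) := by
        rw [map_sub]; abel
      rw [this]
      exact (hQ i).2
    obtain ⟨l', hl'⟩ := cauchySeq_tendsto_of_complete hcauchy
    obtain ⟨x, hx⟩ := hconv ⟨l' + l, by simpa using hl'.add hl⟩ (by
      intro δ hδ
      obtain ⟨δ', hδ', hA⟩ := H.exists_forall_norm_le hδ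
      obtain ⟨K0, hK0⟩ := eventually_tailFilter.1 hA
      filter_upwards [Metric.tendsto_nhds.1 hp δ' hδ', eventually_ge_atTop K0] with i hi hiK
      refine hK0 _ (hΓ i) (fun n hn => hz i n ?_) fun n => ?_
      · exact (hn.le.trans hiK).trans (hK.id_le i)
      · obtain ⟨j, hj⟩ := (hQ i).1
        rw [dist_zero_right] at hi
        rw [hj]
        by_cases hjn : j ≤ n <;> simp [stepSeq, hjn, hi.le, hδ'.le])
    exact ⟨x, (hx.comp hK.tendsto_atTop).congr hwK⟩)
  exact isoToClosedSubspace_of_le_norm S hc hcS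

theorem IsoToClosedSubspace.borelReducible (h : IsoToClosedSubspace X Y) :
    BorelReducible (inducedEquivRel X) (inducedEquivRel Y) := by
  obtain ⟨Z, hZ, ⟨e⟩⟩ := h
  refine ⟨fun x n => (e (x n) : Y), ?_, fun a b => ?_⟩
  · have hc : Continuous fun (x : ℕ → X) n => (e (x n) : Y) := by fun_prop
    exact hc.borel_measurable
  · have key : ∀ s : ℕ → X, (∃ l, Tendsto s atTop (𝓝 l)) ↔
        ∃ l, Tendsto (fun n => (e (s n) : Y)) atTop (𝓝 l) := by
      intro s
      constructor
      · rintro ⟨l, hl⟩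
        exact ⟨e l, ((continuous_subtype_val.comp e.continuous).tendsto l).comp hl⟩
      · rintro ⟨l, hl⟩
        have hlZ : l ∈ Z := hZ.mem_of_tendsto hl (Eventually.of_forall fun n => (e (s n)).2)
        have h1 : Tendsto (fun n => e (s n)) atTop (𝓝 (⟨l, hlZ⟩ : Z)) :=
          tendsto_subtype_rng.2 hl
        exact ⟨e.symm ⟨l, hlZ⟩, ((e.symm.continuous.tendsto _).comp h1).congr fun n =>
          e.symm_apply_apply (s n)⟩
    have := key fun n => a n - b n
    simp only [map_sub, Submodule.coe_sub] at this
    exact this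

end Embedding

/-! ### Rosenthal's lemma and the theorem of Bessaga and Pełczyński. -/

/-- Rosenthal's lemma: a nonnegative matrix with bounded row sums has an infinite square submatrix
whose off-diagonal row sums are small. -/
theorem exists_injective_offDiag_sum_le {ε : ℝ} (hε : 0 < ε) (a : ℕ → ℕ → ℝ)
    (ha : ∀ k i, 0 ≤ a k i) (C : ℝ) (hC : ∀ k, ∀ F : Finset ℕ, ∑ i ∈ F, a k i ≤ C) :
    ∃ φ : ℕ → ℕ, Function.Injective φ ∧
      ∀ k, ∀ F : Finset ℕ, k ∉ F → ∑ i ∈ F, a (φ k) (φ i) ≤ ε := by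
  classical
  obtain ⟨N, hN⟩ := exists_nat_ge (C / ε)
  rw [div_le_iff₀ hε] at hN
  induction N generalizing a C with
  | zero =>
    refine ⟨id, Function.injective_id, fun k F _ => (hC k F).trans ?_⟩
    rw [Nat.cast_zero, zero_mul] at hN
    exact hN.trans hε.le
  | succ N ih =>
    -- `Nat.pair` splits `ℕ` into infinitely many infinite blocks. If no block works, each block `p`
    -- has a row with off-diagonal mass above `ε` inside the block. Keeping only these rows and
    -- their columns discards that mass, so the bound drops to `C - ε`.
    by_cases hp : ∃ p : ℕ, ∀ k, ∀ F : Finset ℕ, k ∉ F →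
        ∑ i ∈ F, a (Nat.pair p k) (Nat.pair p i) ≤ ε
    · obtain ⟨p, hp⟩ := hp
      exact ⟨Nat.pair p, fun i j hij => (Nat.pair_eq_pair.1 hij).2, hp⟩
    · push Not at hp
      choose k F hkF hF using hp
      let φ : ℕ → ℕ := fun p => Nat.pair p (k p)
      have hφ : Function.Injective φ := fun i j hij => (Nat.pair_eq_pair.1 hij).1
      obtain ⟨ψ, hψ, hψs⟩ := ih (fun p q => a (φ p) (φ q)) (fun _ _ => ha _ _) (C - ε)
        (fun p G => by
          have hinj : Function.Injective (Nat.pair p) := fun i j hij => (Nat.pair_eq_pair.1 hij).2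
          have hdisj : Disjoint (G.image φ) ((F p).image (Nat.pair p)) := by
            rw [Finset.disjoint_left]
            intro x hx hx'
            obtain ⟨q, -, rfl⟩ := Finset.mem_image.1 hx
            obtain ⟨i, hi, hqi⟩ := Finset.mem_image.1 hx'
            obtain ⟨rfl, rfl⟩ := Nat.pair_eq_pair.1 hqi
            exact hkF _ hi
          have h := hC (φ p) (G.image φ ∪ (F p).image (Nat.pair p))
          rw [Finset.sum_union hdisj, Finset.sum_image hφ.injOn, Finset.sum_image hinj.injOn] at h
          linarith [hF p])
        (by push_cast at hN; linarith)
      exact ⟨φ ∘ ψ, hφ.comp hψ, hψs⟩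

section BessagaPelczynski

variable {Y : Type*} [NormedAddCommGroup Y] [NormedSpace ℝ Y]

/-- Split `F` by the sign of `g (y i)`: each part contributes at most `M`. -/
theorem sum_abs_dual_le_of_bounded_subset_sums {y : ℕ → Y} {M : ℝ}
    (hy : ∀ F : Finset ℕ, ‖∑ i ∈ F, y i‖ ≤ M) {g : StrongDual ℝ Y} (hg : ‖g‖ ≤ 1)
    (F : Finset ℕ) : ∑ i ∈ F, |g (y i)| ≤ 2 * M := by
  have hb : ∀ G : Finset ℕ, |∑ i ∈ G, g (y i)| ≤ M := fun G => by
    rw [← map_sum, ← Real.norm_eq_abs]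
    exact (g.le_of_opNorm_le hg _).trans ((one_mul _).le.trans (hy G))
  rw [← Finset.sum_filter_add_sum_filter_not F fun i => 0 ≤ g (y i),
    Finset.sum_congr rfl fun i hi => abs_of_nonneg (Finset.mem_filter.1 hi).2,
    Finset.sum_congr (s₁ := F.filter fun i => ¬ 0 ≤ g (y i)) rfl fun i hi =>
      abs_of_neg (not_le.1 (Finset.mem_filter.1 hi).2), Finset.sum_neg_distrib]
  have h1 := (abs_le.1 (hb (F.filter fun i => 0 ≤ g (y i)))).2
  have h2 := (abs_le.1 (hb (F.filter fun i => ¬ 0 ≤ g (y i)))).1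
  linarith

theorem norm_sum_smul_le_of_bounded_subset_sums {y : ℕ → Y} {M : ℝ}
    (hy : ∀ F : Finset ℕ, ‖∑ i ∈ F, y i‖ ≤ M) {c : ℕ → ℝ} {A : ℝ} (hA : 0 ≤ A) (F : Finset ℕ)
    (hc : ∀ i ∈ F, |c i| ≤ A) : ‖∑ i ∈ F, c i • y i‖ ≤ A * (2 * M) := by
  obtain ⟨g, hg, hgx⟩ := exists_dual_vector'' ℝ (∑ i ∈ F, c i • y i)
  have hgx' : g (∑ i ∈ F, c i • y i) = ‖∑ i ∈ F, c i • y i‖ := hgx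
  rw [← hgx', map_sum]
  calc ∑ i ∈ F, g (c i • y i) ≤ ∑ i ∈ F, A * |g (y i)| := by
        refine Finset.sum_le_sum fun i hi => ?_
        rw [map_smul, smul_eq_mul]
        refine (le_abs_self _).trans ?_
        rw [abs_mul]
        exact mul_le_mul_of_nonneg_right (hc i hi) (abs_nonneg _)
    _ ≤ A * (2 * M) := by
        rw [← Finset.mul_sum]
        exact mul_le_mul_of_nonneg_left (sum_abs_dual_le_of_bounded_subset_sums hy hg F) hA

/-- Bessaga–Pełczyński: in a Banach space without a copy of `c₀`, the terms of a series with bounded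
subset sums tend to zero. -/
theorem tendsto_zero_of_bounded_subset_sums [CompleteSpace Y]
    (hY : ¬ IsoToClosedSubspace C₀(ℕ, ℝ) Y) (y : ℕ → Y)
    (hy : ∃ M, ∀ F : Finset ℕ, ‖∑ i ∈ F, y i‖ ≤ M) : Tendsto y atTop (𝓝 0) := by
  classical
  obtain ⟨M, hM⟩ := hy
  by_contra hcon
  obtain ⟨δ, hδ, hfr⟩ : ∃ δ > 0, ∃ᶠ i in atTop, δ ≤ ‖y i‖ := by
    by_contra! h
    refine hcon (Metric.tendsto_nhds.2 fun ε hε => ?_)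
    filter_upwards [h ε hε] with i hi
    rwa [dist_zero_right]
  obtain ⟨φ₀, hφ₀, hyφ⟩ := extraction_of_frequently_atTop hfr
  have hsub : ∀ φ : ℕ → ℕ, Function.Injective φ → ∀ F : Finset ℕ, ‖∑ i ∈ F, y (φ i)‖ ≤ M := by
    intro φ hφ F
    rw [← Finset.sum_image (f := y) hφ.injOn]
    exact hM _
  choose g hg hgy using fun k => exists_dual_vector'' ℝ (y (φ₀ k))
  -- The diagonal entries are at least `δ`, so off-diagonal row sums of at most `δ / 2` make the
  -- norming functionals nearly biorthogonal.
  obtain ⟨φ₁, hφ₁, hoff⟩ := exists_injective_offDiag_sum_le (show 0 < δ / 2 by positivity)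
    (fun k i => |g k (y (φ₀ i))|) (fun _ _ => abs_nonneg _) (2 * M)
    (fun k F => sum_abs_dual_le_of_bounded_subset_sums (hsub φ₀ hφ₀.injective) (hg k) F)
  let v : ℕ → Y := fun i => y (φ₀ (φ₁ i))
  have hv : ∀ F : Finset ℕ, ‖∑ i ∈ F, v i‖ ≤ M := hsub _ (hφ₀.injective.comp hφ₁)
  have hM0 : 0 ≤ M := by simpa using hM ∅
  have hnorm : ∀ (a : C₀(ℕ, ℝ)) i, |a i| ≤ ‖a‖ := fun a i =>
    BoundedContinuousFunction.norm_coe_le_norm a.toBCF i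
  have hsum : ∀ a : C₀(ℕ, ℝ), Summable fun i => a i • v i := by
    intro a
    refine summable_iff_vanishing_norm.2 fun ε hε => ?_
    have hlim := a.zero_at_infty'
    rw [Filter.cocompact_eq_cofinite] at hlim
    have hpos : 0 < ε / (2 * (2 * M) + 1) := by positivity
    have hfin := Filter.eventually_cofinite.1 (Metric.tendsto_nhds.1 hlim _ hpos)
    refine ⟨hfin.toFinset, fun t ht => ?_⟩
    refine (norm_sum_smul_le_of_bounded_subset_sums hv hpos.le t fun i hi => ?_).trans_lt ?_
    · have h1 : i ∉ hfin.toFinset := Finset.disjoint_left.1 ht hi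
      rw [Set.Finite.mem_toFinset] at h1
      have h2 := not_not.1 h1
      rw [dist_zero_right] at h2
      exact h2.le
    · rw [div_mul_eq_mul_div, div_lt_iff₀ (by positivity)]
      nlinarith
  let T₀ : C₀(ℕ, ℝ) →ₗ[ℝ] Y :=
    { toFun := fun a => ∑' i, a i • v i
      map_add' := fun a b => by
        rw [← (hsum a).tsum_add (hsum b)]
        exact tsum_congr fun i => by rw [ZeroAtInftyContinuousMap.add_apply, add_smul]
      map_smul' := fun c a => by
        rw [RingHom.id_apply, ← (hsum a).tsum_const_smul]
        exact tsum_congr fun i => by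
          rw [ZeroAtInftyContinuousMap.smul_apply, smul_eq_mul, mul_smul] }
  let T : C₀(ℕ, ℝ) →L[ℝ] Y := T₀.mkContinuous (2 * M) fun a => by
    rw [mul_comm]
    exact le_of_tendsto (hsum a).hasSum.norm (Eventually.of_forall fun F =>
      norm_sum_smul_le_of_bounded_subset_sums hv (norm_nonneg a) F fun i _ => hnorm a i)
  refine hY (isoToClosedSubspace_of_le_norm T (show 0 < δ / 2 by positivity) fun a => ?_)
  -- The norming functional of `v k` reads off the `k`-th coefficient up to `‖a‖ * (δ / 2)`; the
  -- supremum over `k` then bounds `T` below by `δ / 2`.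
  have hlow : ∀ k, |a k| * δ ≤ ‖T a‖ + ‖a‖ * (δ / 2) := by
    intro k
    have h1 : HasSum (fun i => g (φ₁ k) (a i • v i)) (g (φ₁ k) (T a)) :=
      (hsum a).hasSum.mapL (g (φ₁ k))
    have h2 : |g (φ₁ k) (T a)| ≤ ‖T a‖ := ((g (φ₁ k)).le_of_opNorm_le (hg _) _).trans (one_mul _).le
    have h3 : |a k| * δ - ‖a‖ * (δ / 2) ≤ |g (φ₁ k) (T a)| := by
      refine ge_of_tendsto h1.abs ?_
      filter_upwards [eventually_ge_atTop {k}] with F hF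
      have hk : k ∈ F := hF (Finset.mem_singleton_self k)
      rw [← Finset.add_sum_erase F _ hk]
      have e1 : |g (φ₁ k) (a k • v k)| = |a k| * ‖v k‖ := by
        have : g (φ₁ k) (v k) = ‖v k‖ := hgy (φ₁ k)
        rw [map_smul, smul_eq_mul, abs_mul, this, abs_norm]
      have e2 : |∑ i ∈ F.erase k, g (φ₁ k) (a i • v i)| ≤ ‖a‖ * (δ / 2) := by
        calc |∑ i ∈ F.erase k, g (φ₁ k) (a i • v i)|
            ≤ ∑ i ∈ F.erase k, ‖a‖ * |g (φ₁ k) (v i)| := by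
              refine (Finset.abs_sum_le_sum_abs _ _).trans (Finset.sum_le_sum fun i _ => ?_)
              rw [map_smul, smul_eq_mul, abs_mul]
              exact mul_le_mul_of_nonneg_right (hnorm a i) (abs_nonneg _)
          _ ≤ ‖a‖ * (δ / 2) := by
              rw [← Finset.mul_sum]
              exact mul_le_mul_of_nonneg_left (hoff k _ (Finset.notMem_erase k F)) (norm_nonneg a)
      have e3 : |a k| * δ ≤ |a k| * ‖v k‖ := mul_le_mul_of_nonneg_left (hyφ _) (abs_nonneg _)
      have e4 := abs_sub_abs_le_abs_sub (g (φ₁ k) (a k • v k))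
        (-∑ i ∈ F.erase k, g (φ₁ k) (a i • v i))
      rw [abs_neg, sub_neg_eq_add] at e4
      linarith
    linarith
  have hle : ‖a‖ ≤ (‖T a‖ + ‖a‖ * (δ / 2)) / δ := by
    rw [← ZeroAtInftyContinuousMap.norm_toBCF_eq_norm]
    refine (BoundedContinuousFunction.norm_le (by positivity)).2 fun k => ?_
    rw [le_div_iff₀ hδ]
    exact hlow k
  rw [le_div_iff₀ hδ] at hle
  linarith

end BessagaPelczynski

/-! ### Gliding humps and growth of sums in `ℓ_q`. -/

section SequenceSpaces

variable {q : ℝ≥0∞} [Fact (1 ≤ q)]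

theorem toReal_pos_of_one_le (hq : q ≠ ∞) : 0 < q.toReal :=
  ENNReal.toReal_pos (zero_lt_one.trans_le (Fact.out : 1 ≤ q)).ne' hq

theorem lp.separableSpace_nat (hq : q ≠ ∞) :
    TopologicalSpace.SeparableSpace (lp (fun _ : ℕ => ℝ) q) := by
  rw [← TopologicalSpace.isSeparable_univ_iff]
  have h := ((Set.countable_range fun i : ℕ => lp.single (E := fun _ : ℕ => ℝ) q i (1 : ℝ)).isSeparable.span
    (R := ℝ)).closure
  refine h.mono fun f _ => ?_
  refine mem_closure_of_tendsto (lp.hasSum_single hq f) (Eventually.of_forall fun s => ?_)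
  refine Submodule.sum_mem _ fun i _ => ?_
  have : lp.single (E := fun _ : ℕ => ℝ) q i (f i)
      = (f i : ℝ) • lp.single (E := fun _ : ℕ => ℝ) q i (1 : ℝ) := by
    rw [← lp.single_smul, smul_eq_mul, mul_one]
  rw [this]
  exact Submodule.smul_mem _ _ (Submodule.subset_span ⟨i, rfl⟩)

theorem lp.norm_add_rpow_of_disjoint (hq : q ≠ ∞) (u v : lp (fun _ : ℕ => ℝ) q)
    (h : ∀ n, u n = 0 ∨ v n = 0) :
    ‖u + v‖ ^ q.toReal = ‖u‖ ^ q.toReal + ‖v‖ ^ q.toReal := by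
  have hq' := toReal_pos_of_one_le hq
  rw [lp.norm_rpow_eq_tsum hq', lp.norm_rpow_eq_tsum hq', lp.norm_rpow_eq_tsum hq',
    ← ((lp.memℓp u).summable hq').tsum_add ((lp.memℓp v).summable hq')]
  refine tsum_congr fun n => ?_
  rcases h n with h | h <;> simp [h, Real.zero_rpow hq'.ne']

theorem lp.norm_sum_rpow_of_disjoint (hq : q ≠ ∞) (v : ℕ → lp (fun _ : ℕ => ℝ) q)
    (h : ∀ i j, i ≠ j → ∀ n, v i n = 0 ∨ v j n = 0) (N : ℕ) :
    ‖∑ k ∈ Finset.range N, v k‖ ^ q.toReal = ∑ k ∈ Finset.range N, ‖v k‖ ^ q.toReal := by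
  induction N with
  | zero => simp [Real.zero_rpow (toReal_pos_of_one_le hq).ne']
  | succ N ih =>
    rw [Finset.sum_range_succ, Finset.sum_range_succ, lp.norm_add_rpow_of_disjoint hq, ih]
    intro n
    by_cases hN : v N n = 0
    · exact Or.inr hN
    · left
      rw [lp.coeFn_sum, Finset.sum_apply]
      exact Finset.sum_eq_zero fun k hk =>
        (h k N (Finset.mem_range.1 hk).ne n).resolve_right hN

/-- Gliding hump: along a coordinatewise convergent sequence in `ℓ_q` there are differences of
terms that are close to disjointly supported vectors. -/
theorem lp.exists_disjoint_approx (hq : q ≠ ∞) (x : ℕ → lp (fun _ : ℕ => ℝ) q) (l : ℕ → ℝ)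
    (hx : ∀ j, Tendsto (fun n => x n j) atTop (𝓝 (l j))) {ε : ℝ} (hε : 0 < ε) :
    ∃ (n m : ℕ → ℕ) (v : ℕ → lp (fun _ : ℕ => ℝ) q),
      (∀ k, n k < m k) ∧ (∀ i j, i < j → m i < n j) ∧
      (∀ i j, i ≠ j → ∀ k, v i k = 0 ∨ v j k = 0) ∧
      ∀ k, ‖x (n k) - x (m k) - v k‖ ≤ ε * (1 / 2) ^ k := by
  let R : Finset ℕ → lp (fun _ : ℕ => ℝ) q → lp (fun _ : ℕ => ℝ) q := fun I d =>
    ∑ j ∈ I, lp.single (E := fun _ : ℕ => ℝ) q j (d j)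
  have hR : ∀ I d k, R I d k = if k ∈ I then d k else 0 := by
    intro I d k
    simp only [R, lp.coeFn_sum, Finset.sum_apply, lp.coeFn_single, Finset.sum_pi_single]
  -- In a triple `(n, m, J')` the last entry ends the support of the hump. `A` lies beyond all
  -- indices used so far and `J` beyond all supports.
  let A : ℕ → (ℕ → ℕ × ℕ × ℕ) → ℕ := fun i s => ∑ j ∈ Finset.range i, ((s j).2.1 + 1)
  let J : ℕ → (ℕ → ℕ × ℕ × ℕ) → ℕ := fun i s => ∑ j ∈ Finset.range i, (s j).2.2
  let P : ℕ → (ℕ → ℕ × ℕ × ℕ) → ℕ × ℕ × ℕ → Prop := fun i s a =>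
    A i s ≤ a.1 ∧ a.1 < a.2.1 ∧
    ‖x a.1 - x a.2.1 - R (Finset.Ico (J i s) a.2.2) (x a.1 - x a.2.1)‖ ≤ ε * (1 / 2) ^ i
  obtain ⟨s, hs⟩ := exists_seq_of_forall_history P (by
    intro i s s' a hss
    have e1 : A i s = A i s' :=
      Finset.sum_congr rfl fun j hj => by rw [hss j (Finset.mem_range.1 hj)]
    have e2 : J i s = J i s' :=
      Finset.sum_congr rfl fun j hj => by rw [hss j (Finset.mem_range.1 hj)]
    simp only [P, e1, e2]
    exact id) (fun _ => True) (by
    intro i s _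
    have hη : 0 < ε * (1 / 2) ^ i / 2 := by positivity
    -- Coordinates below `J i s` converge, so late differences are small there; half of the error
    -- covers this head, half the tail after `J'`.
    have hlim : Tendsto (fun n => R (Finset.range (J i s)) (x n)) atTop
        (𝓝 (∑ j ∈ Finset.range (J i s), lp.single (E := fun _ : ℕ => ℝ) q j (l j))) :=
      tendsto_finsetSum _ fun j _ =>
        ((lp.isometry_single (E := fun _ : ℕ => ℝ) (p := q) j).continuous.tendsto _).comp (hx j)
    obtain ⟨A', hA'⟩ := Metric.cauchySeq_iff.1 hlim.cauchySeq _ hη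
    let n := max (A i s) A'
    let d := x n - x (n + 1)
    obtain ⟨J', hJ', hJJ⟩ := ((Metric.tendsto_nhds.1 (lp.hasSum_single hq d).tendsto_sum_nat _ hη).and
      (eventually_ge_atTop (J i s))).exists
    refine ⟨(n, n + 1, J'), trivial, le_max_left _ _, Nat.lt_succ_self n, ?_⟩
    have h1 := hA' n (le_max_right _ _) (n + 1) ((le_max_right _ _).trans (Nat.le_succ n))
    have hsub : R (Finset.range (J i s)) (x n) - R (Finset.range (J i s)) (x (n + 1))
        = R (Finset.range (J i s)) d := by
      simp only [R, ← Finset.sum_sub_distrib, ← lp.single_sub]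
      rfl
    rw [dist_eq_norm, hsub] at h1
    rw [dist_comm, dist_eq_norm] at hJ'
    have h2 : R (Finset.Ico (J i s) J') d = R (Finset.range J') d - R (Finset.range (J i s)) d :=
      Finset.sum_Ico_eq_sub _ hJJ
    change ‖d - R (Finset.Ico (J i s) J') d‖ ≤ _
    have h3 : ‖d - R (Finset.range J') d‖ < ε * (1 / 2) ^ i / 2 := hJ'
    rw [h2, sub_sub_eq_add_sub, add_sub_right_comm]
    linarith [norm_add_le (d - R (Finset.range J') d) (R (Finset.range (J i s)) d)])
  have hJlt : ∀ i j, i < j → (s i).2.2 ≤ J j s := fun i j hij =>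
    Finset.single_le_sum (f := fun j => (s j).2.2) (fun _ _ => Nat.zero_le _)
      (Finset.mem_range.2 hij)
  have hdisj : ∀ i j k, i < j → k ∈ Finset.Ico (J i s) (s i).2.2 →
      k ∉ Finset.Ico (J j s) (s j).2.2 := by
    intro i j k hij h1 h2
    rw [Finset.mem_Ico] at h1 h2
    have := hJlt i j hij
    omega
  refine ⟨fun k => (s k).1, fun k => (s k).2.1, fun k => R (Finset.Ico (J k s) (s k).2.2)
    (x (s k).1 - x (s k).2.1), fun k => (hs k).2.2.1, fun i j hij => ?_, fun i j hij k => ?_,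
    fun k => (hs k).2.2.2⟩
  · have h1 : (s i).2.1 + 1 ≤ A j s :=
      Finset.single_le_sum (f := fun j => (s j).2.1 + 1) (fun _ _ => Nat.zero_le _)
        (Finset.mem_range.2 hij)
    exact (Nat.lt_of_succ_le h1).trans_le (hs j).2.1
  · rw [hR, hR]
    rcases lt_or_gt_of_ne hij with h | h
    · by_cases hk : k ∈ Finset.Ico (J i s) (s i).2.2
      · exact Or.inr (if_neg (hdisj i j k h hk))
      · exact Or.inl (if_neg hk)
    · by_cases hk : k ∈ Finset.Ico (J j s) (s j).2.2
      · exact Or.inl (if_neg (hdisj j i k h hk))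
      · exact Or.inr (if_neg hk)

/-- A bounded separated sequence in `ℓ_q` has differences whose sums grow like `N ^ (1 / q)`. -/
theorem lp.exists_sum_sub_growth (hq : q ≠ ∞) (x : ℕ → lp (fun _ : ℕ => ℝ) q) {B c : ℝ}
    (hB : ∀ n, ‖x n‖ ≤ B) (hc : 0 < c) (hxc : ∀ n m, n ≠ m → c ≤ ‖x n - x m‖) :
    ∃ (n m : ℕ → ℕ) (b K : ℝ), (∀ k, n k < m k) ∧ (∀ i j, i < j → m i < n j) ∧
      ∀ N : ℕ, c / 2 * (N : ℝ) ^ (1 / q.toReal) ≤ ‖∑ k ∈ Finset.range N, (x (n k) - x (m k))‖ + K ∧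
        ‖∑ k ∈ Finset.range N, (x (n k) - x (m k))‖ ≤ b * (N : ℝ) ^ (1 / q.toReal) + K := by
  have hq' := toReal_pos_of_one_le hq
  have hq0 : q ≠ 0 := (zero_lt_one.trans_le (Fact.out : 1 ≤ q)).ne'
  -- Compactness of the product of the intervals `[-B, B]` gives a coordinatewise convergent
  -- subsequence.
  obtain ⟨l, -, φ, hφ, hl⟩ := (isCompact_univ_pi fun _ : ℕ => isCompact_Icc (a := -B) (b := B)).tendsto_subseq
    (x := fun n => (x n : ℕ → ℝ)) (fun n j _ => abs_le.1 ((lp.norm_apply_le_norm hq0 (x n) j).trans (hB n)))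
  obtain ⟨n, m, v, hnm, hmn, hv, happ⟩ := lp.exists_disjoint_approx hq (fun n => x (φ n)) l
    (fun j => (tendsto_pi_nhds.1 hl) j) (show 0 < c / 2 by positivity)
  have hle : ∀ k, ‖x (φ (n k)) - x (φ (m k)) - v k‖ ≤ c / 2 := fun k =>
    (happ k).trans (mul_le_of_le_one_right (by positivity)
      (pow_le_one₀ (by norm_num) (by norm_num)))
  have hB0 : 0 ≤ B := (norm_nonneg _).trans (hB 0)
  have hv1 : ∀ k, c / 2 ≤ ‖v k‖ := by
    intro k
    have h1 := hxc _ _ (hφ (hnm k)).ne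
    have h2 := norm_sub_norm_le (x (φ (n k)) - x (φ (m k))) (v k)
    linarith [hle k]
  have hv2 : ∀ k, ‖v k‖ ≤ 2 * B + c / 2 := by
    intro k
    have h1 := norm_sub_norm_le (v k) (x (φ (n k)) - x (φ (m k)))
    rw [norm_sub_rev (v k)] at h1
    linarith [hle k, norm_sub_le (x (φ (n k))) (x (φ (m k))), hB (φ (n k)), hB (φ (m k))]
  have hpow : ∀ (N : ℕ) (a : ℝ), 0 ≤ a →
      (∑ _k ∈ Finset.range N, a ^ q.toReal) ^ (1 / q.toReal) = a * (N : ℝ) ^ (1 / q.toReal) := by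
    intro N a ha
    rw [Finset.sum_const, Finset.card_range, nsmul_eq_mul, Real.mul_rpow (Nat.cast_nonneg _)
      (Real.rpow_nonneg ha _), ← Real.rpow_mul ha, mul_one_div_cancel hq'.ne', Real.rpow_one, mul_comm]
  have hnorm : ∀ N : ℕ, ‖∑ k ∈ Finset.range N, v k‖
      = (∑ k ∈ Finset.range N, ‖v k‖ ^ q.toReal) ^ (1 / q.toReal) := by
    intro N
    rw [← lp.norm_sum_rpow_of_disjoint hq v hv N, ← Real.rpow_mul (norm_nonneg _),
      mul_one_div_cancel hq'.ne', Real.rpow_one]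
  have herr : ∀ N : ℕ, ‖∑ k ∈ Finset.range N, (x (φ (n k)) - x (φ (m k)))
      - ∑ k ∈ Finset.range N, v k‖ ≤ c := by
    intro N
    rw [← Finset.sum_sub_distrib]
    refine (norm_sum_le_of_le _ fun k _ => happ k).trans ?_
    rw [← Finset.mul_sum]
    have := summable_geometric_two.sum_le_tsum (Finset.range N) fun j _ => by positivity
    rw [tsum_geometric_two] at this
    nlinarith
  refine ⟨fun k => φ (n k), fun k => φ (m k), 2 * B + c / 2, c, fun k => hφ (hnm k),
    fun i j hij => hφ (hmn i j hij), fun N => ?_⟩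
  have e := herr N
  constructor
  · have h1 : c / 2 * (N : ℝ) ^ (1 / q.toReal) ≤ ‖∑ k ∈ Finset.range N, v k‖ := by
      rw [hnorm, ← hpow N (c / 2) (by positivity)]
      gcongr with k
      exact hv1 k
    rw [norm_sub_rev] at e
    linarith [norm_sub_norm_le (∑ k ∈ Finset.range N, v k)
      (∑ k ∈ Finset.range N, (x (φ (n k)) - x (φ (m k))))]
  · have h1 : ‖∑ k ∈ Finset.range N, v k‖ ≤ (2 * B + c / 2) * (N : ℝ) ^ (1 / q.toReal) := by
      rw [hnorm, ← hpow N (2 * B + c / 2) (by positivity)]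
      gcongr with k
      exact hv2 k
    linarith [norm_sub_norm_le (∑ k ∈ Finset.range N, (x (φ (n k)) - x (φ (m k))))
      (∑ k ∈ Finset.range N, v k)]

/-- Divide by `N ^ s`: if `t < s` the right side tends to `0`. -/
theorem le_of_rpow_growth {a b K s t : ℝ} (ha : 0 < a) (hs : 0 < s)
    (h : ∀ N : ℕ, a * (N : ℝ) ^ s ≤ b * (N : ℝ) ^ t + K) : s ≤ t := by
  by_contra! hts
  have h1 : Tendsto (fun N : ℕ => b * (N : ℝ) ^ (-(s - t)) + K * (N : ℝ) ^ (-s)) atTop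
      (𝓝 (b * 0 + K * 0)) :=
    (((tendsto_rpow_neg_atTop (sub_pos.2 hts)).comp tendsto_natCast_atTop_atTop).const_mul b).add
      (((tendsto_rpow_neg_atTop hs).comp tendsto_natCast_atTop_atTop).const_mul K)
  rw [mul_zero, mul_zero, add_zero] at h1
  refine absurd (ge_of_tendsto h1 ?_) (not_le.2 ha)
  filter_upwards [eventually_ge_atTop 1] with N hN
  have hN' : (0 : ℝ) < N := by exact_mod_cast hN
  have hp : (0 : ℝ) < (N : ℝ) ^ (-s) := Real.rpow_pos_of_pos hN' _
  have h2 := mul_le_mul_of_nonneg_right (h N) hp.le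
  rw [add_mul, mul_assoc, mul_assoc, ← Real.rpow_add hN', ← Real.rpow_add hN', add_neg_cancel,
    Real.rpow_zero, mul_one] at h2
  rwa [show -(s - t) = t + -s by ring]

end SequenceSpaces

/-! ### Non-embeddability into `ℓ_q`. -/

section Embeddings

variable {q : ℝ≥0∞} [Fact (1 ≤ q)]

theorem IsoToClosedSubspace.exists_continuousLinearMap {X Y : Type*} [NormedAddCommGroup X]
    [NormedSpace ℝ X] [NormedAddCommGroup Y] [NormedSpace ℝ Y] (h : IsoToClosedSubspace X Y) :
    ∃ (T : X →L[ℝ] Y) (c : ℝ), 0 < c ∧ ∀ x, c * ‖x‖ ≤ ‖T x‖ := by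
  obtain ⟨Z, -, ⟨e⟩⟩ := h
  refine ⟨Z.subtypeL.comp (e : X →L[ℝ] Z), (‖(e.symm : Z →L[ℝ] X)‖ + 1)⁻¹, by positivity, fun x => ?_⟩
  rw [inv_mul_le_iff₀ (by positivity)]
  have h1 := (e.symm : Z →L[ℝ] X).le_opNorm (e x)
  have h2 : (e.symm : Z →L[ℝ] X) (e x) = x := e.symm_apply_apply x
  rw [h2] at h1
  change ‖x‖ ≤ _ * ‖e x‖
  nlinarith [norm_nonneg (e x)]

/-- The image of `e` is bounded and separated, so growth in `ℓ_q` pulls back to differences of `e`.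
Both non-embedding results compare this with the norm in `E`. -/
theorem exists_sum_sub_growth_of_embedding (hq : q ≠ ∞) {E : Type*} [NormedAddCommGroup E]
    [NormedSpace ℝ E] (h : IsoToClosedSubspace E (lp (fun _ : ℕ => ℝ) q)) (e : ℕ → E)
    (he : ∀ n, ‖e n‖ ≤ 1) (hsep : ∀ n m, n ≠ m → 1 ≤ ‖e n - e m‖) :
    ∃ (n m : ℕ → ℕ) (a c A b K : ℝ), 0 < a ∧ 0 < c ∧ (∀ k, n k < m k) ∧ (∀ i j, i < j → m i < n j) ∧
      ∀ N : ℕ, a * (N : ℝ) ^ (1 / q.toReal)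
          ≤ A * ‖∑ k ∈ Finset.range N, (e (n k) - e (m k))‖ + K ∧
        c * ‖∑ k ∈ Finset.range N, (e (n k) - e (m k))‖ ≤ b * (N : ℝ) ^ (1 / q.toReal) + K := by
  obtain ⟨T, c, hc, hT⟩ := h.exists_continuousLinearMap
  obtain ⟨n, m, b, K, hnm, hmn, hg⟩ := lp.exists_sum_sub_growth hq (fun n => T (e n)) (B := ‖T‖) (c := c)
    (fun n => (T.le_opNorm _).trans (mul_le_of_le_one_right (norm_nonneg _) (he n))) hc
    (fun i j hij => by
      rw [← map_sub]
      exact (le_mul_of_one_le_right hc.le (hsep i j hij)).trans (hT _))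
  refine ⟨n, m, c / 2, c, ‖T‖, b, K, by positivity, hc, hnm, hmn, fun N => ?_⟩
  have := hg N
  simp only [← map_sub, ← map_sum] at this
  exact ⟨this.1.trans (add_le_add_left (T.le_opNorm _) K), (hT _).trans this.2⟩

/-- `ℓ_q` contains no isomorphic copy of `c₀` if `q < ∞`. -/
theorem lp.not_isoToClosedSubspace_zeroAtInfty (hq : q ≠ ∞) :
    ¬ IsoToClosedSubspace C₀(ℕ, ℝ) (lp (fun _ : ℕ => ℝ) q) := by
  intro h
  let e : ℕ → C₀(ℕ, ℝ) := fun n =>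
    { toFun := Pi.single n 1
      continuous_toFun := continuous_of_discreteTopology
      zero_at_infty' := by
        rw [Filter.cocompact_eq_cofinite, Nat.cofinite_eq_atTop]
        refine tendsto_atTop_of_eventually_const (i₀ := n + 1) fun i hi => ?_
        exact Pi.single_eq_of_ne (by omega) _ }
  have he : ∀ n j, e n j = if j = n then 1 else 0 := fun n j => Pi.single_apply n 1 j
  have hle : ∀ (f : C₀(ℕ, ℝ)) (A : ℝ), 0 ≤ A → (∀ j, |f j| ≤ A) → ‖f‖ ≤ A := fun f A hA hf => by
    rw [← ZeroAtInftyContinuousMap.norm_toBCF_eq_norm]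
    exact (BoundedContinuousFunction.norm_le hA).2 hf
  have hge : ∀ (f : C₀(ℕ, ℝ)) (j : ℕ), |f j| ≤ ‖f‖ := fun f j =>
    BoundedContinuousFunction.norm_coe_le_norm f.toBCF j
  obtain ⟨n, m, a, c, A, b, K, ha, -, hnm, hmn, hg⟩ := exists_sum_sub_growth_of_embedding hq h e
    (fun n => hle _ _ zero_le_one fun j => by
      rw [he]; split_ifs <;> simp)
    (fun i j hij => by
      refine le_trans (le_of_eq ?_) (hge (e i - e j) i)
      simp [he, hij])
  -- The intervals `[n k, m k]` are disjoint, so the sums of differences keep norm at most `1` while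
  -- the embedding demands growth `N ^ (1 / q)`.
  have hd : ∀ k j, (e (n k) - e (m k)) j ≠ 0 → n k ≤ j ∧ j ≤ m k := by
    intro k j hj
    by_contra hcon
    apply hj
    have h1 := hnm k
    rw [ZeroAtInftyContinuousMap.sub_apply, he, he, if_neg (by omega), if_neg (by omega), sub_zero]
  have hd1 : ∀ k j, |(e (n k) - e (m k)) j| ≤ 1 := by
    intro k j
    rw [ZeroAtInftyContinuousMap.sub_apply, he, he]
    split_ifs <;> simp
  have hsum : ∀ N, ‖∑ k ∈ Finset.range N, (e (n k) - e (m k))‖ ≤ 1 := by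
    intro N
    refine hle _ _ zero_le_one fun j => ?_
    let ev : C₀(ℕ, ℝ) →+ ℝ :=
      { toFun := fun f => f j
        map_zero' := rfl
        map_add' := fun _ _ => rfl }
    change |ev _| ≤ 1
    rw [map_sum]
    by_cases hex : ∃ k ∈ Finset.range N, ev (e (n k) - e (m k)) ≠ 0
    · obtain ⟨k, hk, hkj⟩ := hex
      rw [Finset.sum_eq_single_of_mem k hk fun i _ hik => ?_]
      · exact hd1 k j
      · by_contra hi
        have h1 := hd k j hkj
        have h2 := hd i j hi
        rcases lt_or_gt_of_ne hik with hlt | hgt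
        · have := hmn i k hlt; omega
        · have := hmn k i hgt; omega
    · push Not at hex
      rw [Finset.sum_eq_zero hex, abs_zero]
      exact zero_le_one
  have hq' := toReal_pos_of_one_le hq
  have := le_of_rpow_growth (s := 1 / q.toReal) (t := 0) (b := |A|) (K := K) ha (by positivity)
    fun N => by
      refine (hg N).1.trans ?_
      rw [Real.rpow_zero, mul_one]
      have h1 := mul_le_mul_of_nonneg_right (le_abs_self A)
        (norm_nonneg (∑ k ∈ Finset.range N, (e (n k) - e (m k))))
      have h2 := mul_le_mul_of_nonneg_left (hsum N) (abs_nonneg A)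
      linarith
  exact absurd this (not_le.2 (by positivity))

/-- The spaces `ℓ_p`, `1 ≤ p < ∞`, are pairwise non-embeddable. -/
theorem lp.eq_of_isoToClosedSubspace {p : ℝ≥0∞} [Fact (1 ≤ p)] (hp : p ≠ ∞) (hq : q ≠ ∞)
    (h : IsoToClosedSubspace (lp (fun _ : ℕ => ℝ) p) (lp (fun _ : ℕ => ℝ) q)) : p = q := by
  have hp' := toReal_pos_of_one_le hp
  have hq' := toReal_pos_of_one_le hq
  have hp0 : 0 < p := zero_lt_one.trans_le Fact.out
  let e : ℕ → lp (fun _ : ℕ => ℝ) p := fun n => lp.single (E := fun _ : ℕ => ℝ) p n (1 : ℝ)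
  have he : ∀ n, ‖e n‖ = 1 := fun n => by
    simp only [e]
    rw [lp.norm_single hp0, norm_one]
  have hej : ∀ n j, j ≠ n → e n j = 0 := fun n j hj => lp.single_apply_ne p n _ hj
  have hdisj : ∀ i j, i ≠ j → ∀ k, e i k = 0 ∨ e j k = 0 := by
    intro i j hij k
    by_cases hk : k = i
    · exact Or.inr (hej j k (by omega))
    · exact Or.inl (hej i k hk)
  have hpair : ∀ i j, i ≠ j → ‖e i - e j‖ ^ p.toReal = 2 := by
    intro i j hij
    rw [sub_eq_add_neg, lp.norm_add_rpow_of_disjoint hp, norm_neg, he, he, Real.one_rpow]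
    · norm_num
    · intro k
      rw [lp.coeFn_neg, Pi.neg_apply, neg_eq_zero]
      exact hdisj i j hij k
  obtain ⟨n, m, a, c, A, b, K, ha, hc, hnm, hmn, hg⟩ := exists_sum_sub_growth_of_embedding hq h e
    (fun n => (he n).le) (fun i j hij => by
      rw [← Real.rpow_le_rpow_iff zero_le_one (norm_nonneg _) hp', hpair i j hij, Real.one_rpow]
      exact one_le_two)
  have hsum : ∀ N : ℕ, ‖∑ k ∈ Finset.range N, (e (n k) - e (m k))‖
      = 2 ^ (1 / p.toReal) * (N : ℝ) ^ (1 / p.toReal) := by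
    intro N
    have h1 := lp.norm_sum_rpow_of_disjoint hp (fun k => e (n k) - e (m k)) (fun i j hij k => by
      have hd : ∀ i, (e (n i) - e (m i)) k ≠ 0 → n i ≤ k ∧ k ≤ m i := by
        intro i hi
        by_contra hcon
        apply hi
        have h1 := hnm i
        rw [lp.coeFn_sub, Pi.sub_apply, hej _ _ (by omega), hej _ _ (by omega), sub_zero]
      by_contra! hcon
      have h1 := hd i hcon.1
      have h2 := hd j hcon.2
      rcases lt_or_gt_of_ne hij with hlt | hgt
      · have := hmn i j hlt; omega
      · have := hmn j i hgt; omega) N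
    rw [Finset.sum_congr rfl fun k _ => hpair _ _ (hnm k).ne, Finset.sum_const, Finset.card_range,
      nsmul_eq_mul, mul_comm] at h1
    rw [← Real.mul_rpow zero_le_two (Nat.cast_nonneg N), ← h1, ← Real.rpow_mul (norm_nonneg _),
      mul_one_div_cancel hp'.ne', Real.rpow_one]
  -- The upper bound on the embedding gives one inequality of exponents, its lower bound the other.
  have hqp := le_of_rpow_growth (s := 1 / q.toReal) (t := 1 / p.toReal)
    (b := A * 2 ^ (1 / p.toReal)) (K := K) ha (by positivity) fun N => by
      have := (hg N).1
      rwa [hsum, ← mul_assoc] at this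
  have hpq := le_of_rpow_growth (s := 1 / p.toReal) (t := 1 / q.toReal)
    (a := c * 2 ^ (1 / p.toReal)) (b := b) (K := K) (by positivity) (by positivity) fun N => by
      have := (hg N).2
      rwa [hsum, ← mul_assoc] at this
  have := le_antisymm ((one_div_le_one_div hq' hp').1 hqp) ((one_div_le_one_div hp' hq').1 hpq)
  exact (ENNReal.toReal_eq_toReal_iff' hp hq).1 this

end Embeddings

/-! ### The rigidity theorem. -/

/-- Rigidity: for separable Banach spaces `X` and `Y` with `Y` not containing `c₀`, reducibility of
`E(X)` to `E(Y)` is equivalent to embeddability of `X` into `Y`. -/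
theorem borelReducible_iff_isoToClosedSubspace {X Y : Type*}
    [NormedAddCommGroup X] [NormedSpace ℝ X] [CompleteSpace X] [TopologicalSpace.SeparableSpace X]
    [NormedAddCommGroup Y] [NormedSpace ℝ Y] [CompleteSpace Y] [TopologicalSpace.SeparableSpace Y]
    (hY : ¬ IsoToClosedSubspace C₀(ℕ, ℝ) Y) :
    BorelReducible (inducedEquivRel X) (inducedEquivRel Y) ↔ IsoToClosedSubspace X Y :=
  ⟨isoToClosedSubspace_of_borelReducible (tendsto_zero_of_bounded_subset_sums hY),
    IsoToClosedSubspace.borelReducible⟩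

theorem theorem6 :
    -- rigidity for separable real Banach spaces; `C₀(ℕ, ℝ)` is the sequence space `c₀`
    (∀ (X : Type*) (Y : Type*)
      [NormedAddCommGroup X] [NormedSpace ℝ X] [CompleteSpace X] [TopologicalSpace.SeparableSpace X]
      [NormedAddCommGroup Y] [NormedSpace ℝ Y] [CompleteSpace Y] [TopologicalSpace.SeparableSpace Y],
      ¬ IsoToClosedSubspace C₀(ℕ, ℝ) Y →
        (BorelReducible (inducedEquivRel X) (inducedEquivRel Y) ↔ IsoToClosedSubspace X Y)) ∧
    -- the real sequence spaces `ℓ_p`, for `p, q ∈ [1, ∞)`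
    (∀ (p q : ℝ≥0∞) [Fact (1 ≤ p)] [Fact (1 ≤ q)], p ≠ ∞ → q ≠ ∞ →
      (BorelReducible (inducedEquivRel (lp (fun _ : ℕ => ℝ) p))
        (inducedEquivRel (lp (fun _ : ℕ => ℝ) q)) ↔ p = q)) := by
  refine ⟨fun X Y _ _ _ _ _ _ _ _ hY => borelReducible_iff_isoToClosedSubspace hY, ?_⟩
  intro p q _ _ hp hq
  constructor
  · intro h
    have := lp.separableSpace_nat hp
    have := lp.separableSpace_nat hq
    exact lp.eq_of_isoToClosedSubspace hp hq
      ((borelReducible_iff_isoToClosedSubspace (lp.not_isoToClosedSubspace_zeroAtInfty hq)).1 h)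
  · rintro rfl
    exact ⟨id, measurable_id, fun _ _ => Iff.rfl⟩
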